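/- Let $\lambda>0$. There exist constants $c_0,c_1>0$ depending only on $\lambda$ such that the following holds. Let $\mathcal N$ be a homogeneous Poisson point process of intensity $\lambda$ on $\mathbb R^2$. For $\mathbf x\in\mathbb R^2$ and a point set $S$ let $h(\mathbf x,S)$ be the point of $S\cap\{\mathbf y:\mathbf y(2)>\mathbf x(2)\}$ that is $\ell_\infty$-nearest to $\mathbf x$ (almost surely unique below). Fix $\mathbf x\in\mathbb R^2$ and let $g_0=\mathbf x$, $g_{n+1}=h(g_n,\mathcal N)$ be the $\ell_\infty$ directed spanning forest path from $\mathbf x$. Put $H_0=\emptyset$ and $$H_{n+1}=\bigl(H_n\cup B^+(g_n,\|g_n-g_{n+1}\|_\infty)\bigr)\cap\{\mathbf y:\mathbf y(2)>g_{n+1}(2)\},$$ where $B^+(\mathbf u,r)=\{\mathbf y:\|\mathbf y-\mathbf u\|_\infty<r,\ \mathbf y(2)>\mathbf u(2)\}$. Let $\mathcal F_n=\sigma(g_0,\dots,g_n)$, $\beta_0=0$ and $\beta_{\ell+1}=\inf\{n>\beta_\ell: H_n=\emptyset\}$ (with $\inf\emptyset=\infty$). Then every $\beta_\ell$ is an almost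 surely finite stopping time with respect to $(\mathcal F_n)$, and for all integers $\ell,n\ge 0$, $$\mathbb P\bigl(\beta_{\ell+1}-\beta_\ell>n \,\big|\, \mathcal F_{\beta_\ell}\bigr)\le c_0e^{-c_1n}\quad\text{almost surely.}$$ The same holds, with the same constants, for the resampled exploration $g_0=\mathbf x$, $g_{n+1}=h(g_n,\mathcal N_{n+1}\setminus H_n)$, where $\mathcal N_1,\mathcal N_2,\dots$ are independent Poisson point processes of intensity $\lambda$ and $H_n,\mathcal F_n,\beta_\ell$ are defined by the same formulas. -/

import Mathlib

open MeasureTheory ProbabilityTheory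

noncomputable section

namespace DSF

/-! The plane is `ℝ × ℝ`, whose norm in Mathlib is the `ℓ∞` (maximum) norm. -/

/-- `N` is (the random set of points of) a homogeneous Poisson point process of intensity `lam` on
the plane: a random locally finite set whose counts on Borel sets are random variables, Poisson
distributed with parameter `lam * |B|`, and independent on disjoint Borel sets. -/
structure IsPoissonProcess {Ω : Type*} [MeasurableSpace Ω] (μ : Measure Ω) (lam : ℝ)
    (N : Ω → Set (ℝ × ℝ)) : Prop where
  locallyFinite : ∀ ω, ∀ B : Set (ℝ × ℝ), Bornology.IsBounded B → (N ω ∩ B).Finite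
  measurable_count : ∀ B : Set (ℝ × ℝ), MeasurableSet B → Measurable fun ω => (N ω ∩ B).encard
  count_law : ∀ B : Set (ℝ × ℝ), MeasurableSet B → volume B ≠ ⊤ → ∀ k : ℕ,
    μ {ω | (N ω ∩ B).encard = k} = ENNReal.ofReal
      (Real.exp (-(lam * volume.real B)) * (lam * volume.real B) ^ k / (k.factorial : ℝ))
  indep_counts : ∀ (m : ℕ) (B : Fin m → Set (ℝ × ℝ)), (∀ i, MeasurableSet (B i)) →
    Pairwise (fun i j => Disjoint (B i) (B j)) → iIndepFun (fun i ω => (N ω ∩ B i).encard) μ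

/-- The σ-algebra generated by a random set of points, i.e. by its counts on Borel sets. -/
def pointSigma {Ω : Type*} (N : Ω → Set (ℝ × ℝ)) : MeasurableSpace Ω :=
  ⨆ (B : Set (ℝ × ℝ)) (_ : MeasurableSet B),
    MeasurableSpace.comap (fun ω => (N ω ∩ B).encard) inferInstance

/-- The open half-plane `{y : y(2) > r}`. -/
def upperHalfPlane (r : ℝ) : Set (ℝ × ℝ) := {y | r < y.2}

/-- The upper part `B⁺(x, r)` of the open `ℓ∞` ball of radius `r` centred at `x`. -/
def upperBall (x : ℝ × ℝ) (r : ℝ) : Set (ℝ × ℝ) := Metric.ball x r ∩ upperHalfPlane x.2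

/-- `y` is a point of `S` with strictly larger second coordinate than `x`, and is `ℓ∞`-nearest to
`x` among all such points. -/
def IsNearestAbove (x : ℝ × ℝ) (S : Set (ℝ × ℝ)) (y : ℝ × ℝ) : Prop :=
  (y ∈ S ∧ x.2 < y.2) ∧ ∀ z ∈ S, x.2 < z.2 → ‖y - x‖ ≤ ‖z - x‖

open Classical in
/-- The ancestor `h(x, S)`: the `ℓ∞`-nearest point of `S` above `x`. In the absence of a unique
nearest point (an event of probability zero for a Poisson process) the value is `x`. -/
def ancestor (x : ℝ × ℝ) (S : Set (ℝ × ℝ)) : ℝ × ℝ :=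
  if h : ∃! y, IsNearestAbove x S y then h.choose else x

/-- The history set after a step from `x` to `y`, if it was `H` before the step. -/
def nextHistory (H : Set (ℝ × ℝ)) (x y : ℝ × ℝ) : Set (ℝ × ℝ) :=
  (H ∪ upperBall x ‖x - y‖) ∩ upperHalfPlane y.2

/-- The history sets `H_n` along a single path `g_0, g_1, …`. -/
def history (g : ℕ → ℝ × ℝ) : ℕ → Set (ℝ × ℝ)
  | 0 => ∅
  | n + 1 => nextHistory (history g n) (g n) (g (n + 1))

/-- The path `x, h(x), h²(x), …` of the directed spanning forest on the points `S`. -/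
def path (S : Set (ℝ × ℝ)) (x : ℝ × ℝ) : ℕ → ℝ × ℝ
  | 0 => x
  | n + 1 => ancestor (path S x n) S

/-- The exploration of a single path in which the `(n+1)`-st step uses the fresh points `S (n+1)`
outside the current history set; the state after `n` steps is the pair (position, history set). -/
def resampledState (S : ℕ → Set (ℝ × ℝ)) (x : ℝ × ℝ) : ℕ → (ℝ × ℝ) × Set (ℝ × ℝ)
  | 0 => (x, ∅)
  | n + 1 =>
    let s := resampledState S x n
    let y := ancestor s.1 (S (n + 1) \ s.2)
    (y, nextHistory s.2 s.1 y)

/-- The positions of the resampled exploration. -/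
def resampledPath (S : ℕ → Set (ℝ × ℝ)) (x : ℝ × ℝ) (n : ℕ) : ℝ × ℝ := (resampledState S x n).1

/-- The history set carried in the state of the resampled exploration is the history set along its
path of positions. -/
theorem history_resampledPath (S : ℕ → Set (ℝ × ℝ)) (x : ℝ × ℝ) (n : ℕ) :
    history (resampledPath S x) n = (resampledState S x n).2 := by
  induction n with
  | zero => rfl
  | succ n ih => simp only [history, ih, resampledPath, resampledState]

/-- The renewal steps `β_ℓ` of a path: `β_0 = 0` and `β_{ℓ+1} = inf {n > β_ℓ : H_n = ∅}`, with
`inf ∅ = ∞`. -/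
def renewalStep (g : ℕ → ℝ × ℝ) : ℕ → ℕ∞
  | 0 => 0
  | l + 1 => sInf {m : ℕ∞ | ∃ n : ℕ, m = n ∧ renewalStep g l < n ∧ history g n = ∅}

end DSF

end

/-! Let `l` be the height of the history set above the current position. A step from `x` to `y`
replaces `l` by `max l ‖x - y‖ - (y.2 - x.2)`, and the history set is empty exactly when its height
is `0` (`history_eq_empty_iff`). A renewal is therefore a visit of `l` to `0`, and the task is to
bound the time until that visit.

Given the past, the next position is the nearest point of a Poisson process restricted to the
half-plane above `x` minus the history set. With independent resampling this is immediate. For a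
single process it says that the explored region carries no information on the rest, which is proved
by induction with Mecke's formula (`IsPoissonLaw.mecke`, `IsFresh.succ`). After this, both
explorations are treated together as an `IsExploration`.

One step is analysed for any obstacle that is closed under moving down, with bounds depending only
on its height. If `l` is large, a step rarely exceeds `l` by much, since a wide free box lies just
above the obstacle, while its vertical part is at least a fixed `ε` with probability at least `1 /
4`. Hence `exp l` contracts on average. If `l` is bounded, the step leads directly above the
obstacle with probability bounded below and a renewal occurs. With a small weight `η`, the function
`1 + η * exp l`, set to zero at `l = 0`, thus loses a fixed factor `ρ < 1` in each step
(`exists_lyapunov_drift`).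

Iterating from a renewal, where the function without the killing equals `1 + η`, the probability of
no renewal in `k` steps is at most `(1 + η) * ρ ^ k` (`measure_history_ne_empty_le`). Decomposing
over the values of `β_ℓ` turns this into the conditional bound. -/

noncomputable section

open scoped ENNReal

namespace DSF

/-! ### Locally finite configurations, with the σ-algebra of void events. -/

/-- A locally finite set of points of the plane. -/
structure Config where
  carrier : Set (ℝ × ℝ)
  finite_inter : ∀ B : Set (ℝ × ℝ), Bornology.IsBounded B → (carrier ∩ B).Finite

namespace Config

/-- The configurations without points in `B`. -/
def void (B : Set (ℝ × ℝ)) : Set Config := {S | Disjoint S.carrier B}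

theorem mem_void {S : Config} {B : Set (ℝ × ℝ)} : S ∈ void B ↔ Disjoint S.carrier B := Iff.rfl

/-- The void events of Borel sets. -/
def voidEvents : Set (Set Config) := {A | ∃ B, MeasurableSet B ∧ A = void B}

/-- The void events form a π-system, so identities between laws need only be tested on them. Counts
are also measurable for this σ-algebra, see `measurable_encard`. -/
instance : MeasurableSpace Config := .generateFrom voidEvents

theorem void_union (A B : Set (ℝ × ℝ)) : void (A ∪ B) = void A ∩ void B := by
  ext S; simp [mem_void]

theorem void_empty : void ∅ = Set.univ := by ext S; simp [mem_void]

theorem isPiSystem_voidEvents : IsPiSystem voidEvents := by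
  rintro _ ⟨A, hA, rfl⟩ _ ⟨B, hB, rfl⟩ -
  exact ⟨A ∪ B, hA.union hB, (void_union A B).symm⟩

theorem measurableSet_void {B : Set (ℝ × ℝ)} (hB : MeasurableSet B) : MeasurableSet (void B) :=
  MeasurableSpace.measurableSet_generateFrom ⟨B, hB, rfl⟩

theorem isCountablySpanning_voidEvents : IsCountablySpanning voidEvents :=
  ⟨fun _ => Set.univ, fun _ => ⟨∅, .empty, void_empty.symm⟩, Set.iUnion_const _⟩

theorem measurable_of_void {α : Type*} [MeasurableSpace α] {f : α → Config}
    (h : ∀ B, MeasurableSet B → MeasurableSet {a | Disjoint (f a).carrier B}) : Measurable f := by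
  refine measurable_generateFrom ?_
  rintro _ ⟨B, hB, rfl⟩
  exact h B hB

theorem countable (S : Config) : S.carrier.Countable := by
  have : S.carrier = ⋃ n : ℕ, S.carrier ∩ Metric.ball 0 n := by
    rw [← Set.inter_iUnion, Metric.iUnion_ball_nat, Set.inter_univ]
  rw [this]
  exact Set.countable_iUnion fun n => (S.finite_inter _ Metric.isBounded_ball).countable

/-- The restriction of a configuration to a set. -/
def restrict (S : Config) (C : Set (ℝ × ℝ)) : Config :=
  ⟨S.carrier ∩ C, fun B hB => (S.finite_inter B hB).subset
    (Set.inter_subset_inter_left _ Set.inter_subset_left)⟩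

/-- The configuration with an additional point. -/
def insert (y : ℝ × ℝ) (S : Config) : Config :=
  ⟨Insert.insert y S.carrier, fun B hB => ((S.finite_inter B hB).insert y).subset (by
    rintro z ⟨rfl | hz, hB⟩
    · exact Or.inl rfl
    · exact Or.inr ⟨hz, hB⟩)⟩

theorem insert_mem_void {y : ℝ × ℝ} {S : Config} {B : Set (ℝ × ℝ)} :
    insert y S ∈ void B ↔ y ∉ B ∧ S ∈ void B := by
  simp [mem_void, insert, Set.disjoint_insert_left]

theorem measurable_insert : Measurable fun p : (ℝ × ℝ) × Config => insert p.1 p.2 := by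
  refine measurable_of_void fun B hB => ?_
  have : {p : (ℝ × ℝ) × Config | Disjoint (insert p.1 p.2).carrier B} = Bᶜ ×ˢ void B := by
    ext p; exact insert_mem_void
  rw [this]
  exact hB.compl.prod (measurableSet_void hB)

/-- The square cell of side `1 / n` containing a point. -/
def cell (n : ℕ) (y : ℝ × ℝ) : ℤ × ℤ := (⌊n * y.1⌋, ⌊n * y.2⌋)

theorem measurable_cell (n : ℕ) : Measurable (cell n) := by
  unfold cell; fun_prop

theorem eventually_cell_ne {a b : ℝ × ℝ} (h : a ≠ b) : ∀ᶠ n in Filter.atTop, cell n a ≠ cell n b := by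
  have key : ∀ s t : ℝ, s ≠ t → ∀ᶠ n : ℕ in Filter.atTop, ⌊n * s⌋ ≠ ⌊n * t⌋ := by
    intro s t hst
    have hpos : 0 < |s - t| := abs_pos.2 (sub_ne_zero.2 hst)
    obtain ⟨N, hN⟩ := exists_nat_gt (1 / |s - t|)
    filter_upwards [Filter.eventually_ge_atTop N] with n hn heq
    have h1 := Int.abs_sub_lt_one_of_floor_eq_floor heq
    rw [← mul_sub, abs_mul, Nat.abs_cast] at h1
    rw [div_lt_iff₀ hpos] at hN
    have : (N : ℝ) ≤ n := by exact_mod_cast hn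
    nlinarith
  rcases not_and_or.1 (fun hh => h (Prod.ext hh.1 hh.2)) with h | h
  · filter_upwards [key _ _ h] with n hn heq using hn (congrArg Prod.fst heq)
  · filter_upwards [key _ _ h] with n hn heq using hn (congrArg Prod.snd heq)

/-- A fine enough grid separates finitely many points, so the number of points is the supremum over
grids of the number of occupied cells. Being occupied is the complement of a void event, which makes
counts measurable. -/
theorem iSup_encard_image_cell (A : Set (ℝ × ℝ)) : ⨆ n, (cell n '' A).encard = A.encard := by
  refine le_antisymm (iSup_le fun n => Set.encard_image_le _ _) ?_
  refine le_of_forall_lt fun c hc => ?_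
  -- As `A` may be infinite, a finite subset with `c + 1` points is separated for each `c` below the
  -- cardinality.
  obtain ⟨T, hTA, hT⟩ := Set.exists_subset_encard_eq (Order.add_one_le_of_lt hc)
  have hcT : c ≠ ⊤ := hc.ne_top
  have hTfin : T.Finite := by
    refine Set.encard_lt_top_iff.1 ?_
    rw [hT]
    exact WithTop.add_lt_top.2 ⟨hcT.lt_top, ENat.one_lt_top⟩
  have : ∀ᶠ n in Filter.atTop, ∀ a ∈ T, ∀ b ∈ T, a ≠ b → cell n a ≠ cell n b := by
    rw [Filter.eventually_all_finite hTfin]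
    intro a _
    rw [Filter.eventually_all_finite hTfin]
    intro b _
    by_cases hab : a = b
    · simp [hab]
    · filter_upwards [eventually_cell_ne hab] with n hn _ using hn
  obtain ⟨n, hn⟩ := this.exists
  have hinj : Set.InjOn (cell n) T := fun a ha b hb hab => by
    by_contra hne
    exact hn a ha b hb hne hab
  calc c < c + 1 := by
          exact (ENat.lt_add_one_iff hcT).2 le_rfl
    _ = (cell n '' T).encard := by rw [hinj.encard_image, hT]
    _ ≤ (cell n '' A).encard := Set.encard_le_encard (Set.image_mono hTA)
    _ ≤ _ := le_iSup (fun n => (cell n '' A).encard) n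

theorem measurable_encard {B : Set (ℝ × ℝ)} (hB : MeasurableSet B) :
    Measurable fun S : Config => ((S.carrier ∩ B).encard : ℝ≥0∞) := by
  have h1 : ∀ S : Config, ((S.carrier ∩ B).encard : ℝ≥0∞)
      = ⨆ n, ∑' i, (void (B ∩ cell n ⁻¹' {i}))ᶜ.indicator 1 S := by
    intro S
    rw [← iSup_encard_image_cell, ENat.toENNReal_iSup]
    refine iSup_congr fun n => ?_
    rw [← ENNReal.tsum_set_one, tsum_subtype (cell n '' (S.carrier ∩ B)) (fun _ => (1 : ℝ≥0∞))]
    refine tsum_congr fun i => ?_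
    have : i ∈ cell n '' (S.carrier ∩ B) ↔ S ∈ (void (B ∩ cell n ⁻¹' {i}))ᶜ := by
      simp only [Set.mem_image, Set.mem_compl_iff, mem_void, Set.not_disjoint_iff]
      constructor
      · rintro ⟨y, ⟨h1, h2⟩, rfl⟩; exact ⟨y, h1, h2, rfl⟩
      · rintro ⟨y, h1, h2, h3⟩; exact ⟨y, ⟨h1, h2⟩, h3⟩
    by_cases h : i ∈ cell n '' (S.carrier ∩ B)
    · rw [Set.indicator_of_mem h, Set.indicator_of_mem (this.1 h)]; rfl
    · rw [Set.indicator_of_notMem h, Set.indicator_of_notMem (fun h' => h (this.2 h'))]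
  simp_rw [h1]
  refine Measurable.iSup fun n => Measurable.tsum fun i => ?_
  exact measurable_one.indicator (measurableSet_void
    (hB.inter (measurable_cell n (measurableSet_singleton i)))).compl

/-- The counting measure of a configuration, as a kernel. -/
def count : Kernel Config (ℝ × ℝ) where
  toFun S := Measure.count.restrict S.carrier
  measurable' := by
    refine Measure.measurable_of_measurable_coe _ fun B hB => ?_
    have : ∀ S : Config, Measure.count.restrict S.carrier B = ((S.carrier ∩ B).encard : ℝ≥0∞) := by
      intro S
      rw [Measure.restrict_apply hB, Set.inter_comm,
        Measure.count_apply (S.countable.measurableSet.inter hB)]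
    simp_rw [this]
    exact measurable_encard hB

theorem count_apply (S : Config) {B : Set (ℝ × ℝ)} (hB : MeasurableSet B) :
    count S B = ((S.carrier ∩ B).encard : ℝ≥0∞) := by
  change Measure.count.restrict S.carrier B = _
  rw [Measure.restrict_apply hB, Set.inter_comm,
    Measure.count_apply (S.countable.measurableSet.inter hB)]

theorem count_eq_zero_iff {S : Config} {B : Set (ℝ × ℝ)} (hB : MeasurableSet B) :
    count S B = 0 ↔ S ∈ void B := by
  rw [count_apply S hB, mem_void, Set.disjoint_iff_inter_eq_empty]
  simp

theorem lintegral_count (S : Config) (f : ℝ × ℝ → ℝ≥0∞) :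
    ∫⁻ y, f y ∂(count S) = ∑' y : S.carrier, f y := by
  change ∫⁻ y in S.carrier, f y ∂Measure.count = _
  rw [← lintegral_subtype_comap S.countable.measurableSet]
  have : Countable S.carrier := S.countable.to_subtype
  have h2 : Measure.comap Subtype.val (Measure.count : Measure (ℝ × ℝ)) =
      (Measure.count : Measure S.carrier) := by
    ext B hB
    rw [comap_subtype_coe_apply S.countable.measurableSet,
      Measure.count_apply (S.countable.measurableSet.subtype_image hB), Measure.count_apply hB,
      Subtype.val_injective.encard_image]
  rw [h2, MeasureTheory.lintegral_count]

/-- Disjoint bounded cells covering the plane. -/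
def annulus (j : ℕ) : Set (ℝ × ℝ) := disjointed (fun n : ℕ => Metric.ball (0 : ℝ × ℝ) n) j

theorem measurableSet_annulus (j : ℕ) : MeasurableSet (annulus j) :=
  MeasurableSet.disjointed (fun _ => measurableSet_ball) j

theorem isBounded_annulus (j : ℕ) : Bornology.IsBounded (annulus j) :=
  Metric.isBounded_ball.subset (disjointed_subset _ j)

-- S-finiteness gives measurability of sections and of parameter integrals. The mass of an annulus
-- is finite but not uniformly bounded, so the kernel is split by annulus and by the number of
-- points there; the piece with `k` points has mass at most `k`.
open Classical in
instance : IsSFiniteKernel count := by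
  have hm : ∀ p : ℕ × ℕ, MeasurableSet {S : Config | count S (annulus p.1) = p.2} := fun p =>
    (count.measurable_coe (measurableSet_annulus p.1)) (measurableSet_singleton _)
  let κ : ℕ × ℕ → Kernel Config (ℝ × ℝ) := fun p =>
    Kernel.piecewise (hm p) (count.restrict (measurableSet_annulus p.1)) 0
  have hκ : ∀ p, IsFiniteKernel (κ p) := by
    intro p
    refine ⟨p.2, ENNReal.natCast_lt_top _, fun S => ?_⟩
    simp only [κ, Kernel.piecewise_apply]
    split_ifs with h
    · rw [Kernel.restrict_apply' _ _ _ .univ, Set.univ_inter]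
      exact le_of_eq h
    · simp
  have hsum : count = Kernel.sum κ := by
    ext S B hB
    rw [Kernel.sum_apply' _ _ hB, ENNReal.tsum_prod']
    have hB' : count S B = ∑' j, count S (B ∩ annulus j) := by
      rw [← measure_iUnion]
      · rw [← Set.inter_iUnion]
        congr 1
        rw [show (⋃ j, annulus j) = Set.univ from by
          unfold annulus; rw [iUnion_disjointed, Metric.iUnion_ball_nat], Set.inter_univ]
      · exact fun i j hij => ((disjoint_disjointed _ hij).mono Set.inter_subset_right
          Set.inter_subset_right)
      · exact fun j => hB.inter (measurableSet_annulus j)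
    rw [hB']
    refine tsum_congr fun j => ?_
    have hfin : (S.carrier ∩ annulus j).Finite := S.finite_inter _ (isBounded_annulus j)
    have hval : count S (annulus j) = ((S.carrier ∩ annulus j).ncard : ℕ) := by
      rw [count_apply S (measurableSet_annulus j), ← hfin.cast_ncard_eq]
      simp
    rw [tsum_eq_single (S.carrier ∩ annulus j).ncard]
    · simp only [κ, Kernel.piecewise_apply, Set.mem_ofPred_eq, hval, if_true]
      rw [Kernel.restrict_apply' _ _ _ hB]
    · intro k hk
      simp only [κ, Kernel.piecewise_apply, Set.mem_ofPred_eq, hval]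
      rw [if_neg]
      · simp
      · intro h; exact hk (by exact_mod_cast h.symm)
  rw [hsum]
  infer_instance

section Parameter
variable {α : Type*} [MeasurableSpace α]

theorem measurable_count_section {T : Set ((α × Config) × (ℝ × ℝ))} (hT : MeasurableSet T) :
    Measurable fun p : α × Config => count p.2 (Prod.mk p ⁻¹' T) :=
  Kernel.measurable_kernel_prodMk_left (κ := count.comap Prod.snd measurable_snd) hT

theorem measurable_lintegral_count {f : (α × Config) × (ℝ × ℝ) → ℝ≥0∞} (hf : Measurable f) :
    Measurable fun p : α × Config => ∫⁻ y, f (p, y) ∂(count p.2) :=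
  Measurable.lintegral_kernel_prod_right (κ := count.comap Prod.snd measurable_snd)
    (f := fun p y => f (p, y)) hf

theorem measurable_restrict {C : α → Set (ℝ × ℝ)}
    (hC : MeasurableSet {p : α × (ℝ × ℝ) | p.2 ∈ C p.1}) :
    Measurable fun p : α × Config => restrict p.2 (C p.1) := by
  refine measurable_of_void fun B hB => ?_
  have hT : MeasurableSet {q : (α × Config) × (ℝ × ℝ) | q.2 ∈ C q.1.1 ∩ B} :=
    ((measurable_fst.fst.prodMk measurable_snd) hC).inter (measurable_snd hB)
  have := measurable_count_section hT (measurableSet_singleton (0 : ℝ≥0∞))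
  convert this using 1
  ext p
  have hs : MeasurableSet (C p.1 ∩ B) := measurable_prodMk_left (x := p) hT
  simp only [Set.mem_ofPred_eq, Set.mem_preimage, Set.mem_singleton_iff]
  change _ ↔ count p.2 (C p.1 ∩ B) = 0
  rw [count_eq_zero_iff hs, mem_void]
  simp only [restrict, Set.disjoint_iff_inter_eq_empty, Set.inter_assoc]

end Parameter

end Config

/-! ### The law of a Poisson process and Mecke's formula. -/

theorem tsum_natCast_mul_poisson {m : ℝ} (hm : 0 ≤ m) :
    ∑' k : ℕ, (k : ℝ≥0∞) * ENNReal.ofReal (Real.exp (-m) * m ^ k / (k.factorial : ℝ))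
      = ENNReal.ofReal m := by
  have h1 : ∑' k : ℕ, ENNReal.ofReal (Real.exp (-m) * m ^ k / (k.factorial : ℝ)) = 1 := by
    have h : HasSum (fun k : ℕ => Real.exp (-m) * m ^ k / (k.factorial : ℝ)) 1 :=
      hasSum_one_poissonMeasure ⟨m, hm⟩
    rw [← ENNReal.ofReal_tsum_of_nonneg (fun k => by positivity) h.summable, h.tsum_eq,
      ENNReal.ofReal_one]
  rw [tsum_eq_zero_add' ENNReal.summable]
  simp only [Nat.cast_zero, zero_mul, zero_add]
  rw [← mul_one (ENNReal.ofReal m), ← h1, ← ENNReal.tsum_mul_left]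
  refine tsum_congr fun k => ?_
  rw [← ENNReal.ofReal_natCast, ← ENNReal.ofReal_mul (by positivity), ← ENNReal.ofReal_mul hm]
  congr 1
  rw [Nat.factorial_succ]
  push_cast
  field_simp
  ring

/-- The properties of the law of a homogeneous Poisson process that are used below. -/
structure IsPoissonLaw (lam : ℝ) (P : Measure Config) : Prop where
  isProbabilityMeasure : IsProbabilityMeasure P
  void_eq : ∀ B, MeasurableSet B → volume B ≠ ⊤ →
    P (Config.void B) = ENNReal.ofReal (Real.exp (-(lam * volume.real B)))
  void_inter : ∀ A B, MeasurableSet A → MeasurableSet B → Disjoint A B →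
    P (Config.void A ∩ Config.void B) = P (Config.void A) * P (Config.void B)
  lintegral_count : ∀ C B, MeasurableSet C → MeasurableSet B → Disjoint C B →
    ∫⁻ S in Config.void B, Config.count S C ∂P
      = ENNReal.ofReal lam * volume C * P (Config.void B)

section ofProcess
variable {Ω : Type*} [MeasurableSpace Ω] {μ : Measure Ω} {lam : ℝ} {N : Ω → Set (ℝ × ℝ)}

/-- The points of a Poisson process as a random configuration. -/
def IsPoissonProcess.config (h : IsPoissonProcess μ lam N) (ω : Ω) : Config :=
  ⟨N ω, h.locallyFinite ω⟩

theorem IsPoissonProcess.comap_config_le (h : IsPoissonProcess μ lam N) :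
    MeasurableSpace.comap h.config inferInstance ≤ pointSigma N := by
  rw [← measurable_iff_comap_le]
  refine @Config.measurable_of_void Ω (pointSigma N) _ fun B hB => ?_
  have h1 : pointSigma N ≥ MeasurableSpace.comap (fun ω => (N ω ∩ B).encard) inferInstance :=
    le_iSup₂_of_le B hB le_rfl
  refine h1 _ ⟨{0}, measurableSet_singleton _, ?_⟩
  ext ω
  simp [config, Set.disjoint_iff_inter_eq_empty]

theorem IsPoissonProcess.pointSigma_le (h : IsPoissonProcess μ lam N) :
    pointSigma N ≤ ‹MeasurableSpace Ω› :=
  iSup₂_le fun B hB => (h.measurable_count B hB).comap_le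

theorem IsPoissonProcess.measurable_config (h : IsPoissonProcess μ lam N) : Measurable h.config :=
  measurable_iff_comap_le.2 (h.comap_config_le.trans h.pointSigma_le)

theorem IsPoissonProcess.indepFun_counts (h : IsPoissonProcess μ lam N) {A B : Set (ℝ × ℝ)}
    (hA : MeasurableSet A) (hB : MeasurableSet B) (hAB : Disjoint A B) :
    IndepFun (fun ω => (N ω ∩ A).encard) (fun ω => (N ω ∩ B).encard) μ := by
  have := h.indep_counts 2 ![A, B] (by simp [Fin.forall_fin_two, hA, hB]) (by
    intro i j hij
    fin_cases i <;> fin_cases j <;> simp_all [disjoint_comm])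
  simpa using this.indepFun (i := 0) (j := 1) (by decide)

theorem IsPoissonProcess.lintegral_encard (h : IsPoissonProcess μ lam N) (hlam : 0 ≤ lam)
    {C : Set (ℝ × ℝ)} (hC : MeasurableSet C) (hb : Bornology.IsBounded C) :
    ∫⁻ ω, ((N ω ∩ C).encard : ℝ≥0∞) ∂μ = ENNReal.ofReal lam * volume C := by
  have hvol : volume C ≠ ⊤ := hb.measure_lt_top.ne
  have hm : Measurable fun ω => (N ω ∩ C).encard := h.measurable_count C hC
  have hn : Measurable fun ω => (N ω ∩ C).encard.toNat :=
    (measurable_from_top (f := ENat.toNat)).comp hm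
  have hcast : ∀ ω, ((N ω ∩ C).encard.toNat : ℕ∞) = (N ω ∩ C).encard := fun ω =>
    ENat.natCast_toNat (Set.encard_ne_top_iff.2 (h.locallyFinite ω C hb))
  have h1 : ∀ ω, ((N ω ∩ C).encard : ℝ≥0∞) = (((N ω ∩ C).encard.toNat : ℕ) : ℝ≥0∞) := by
    intro ω
    conv_lhs => rw [← hcast ω]
    simp
  simp_rw [h1]
  rw [← lintegral_map (f := fun k : ℕ => (k : ℝ≥0∞)) measurable_from_top hn, lintegral_countable']
  have h2 : ∀ k : ℕ, μ.map (fun ω => (N ω ∩ C).encard.toNat) {k} = ENNReal.ofReal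
      (Real.exp (-(lam * volume.real C)) * (lam * volume.real C) ^ k / (k.factorial : ℝ)) := by
    intro k
    rw [Measure.map_apply hn (measurableSet_singleton _), ← h.count_law C hC hvol k]
    congr 1
    ext ω
    simp only [Set.mem_preimage, Set.mem_singleton_iff, Set.mem_ofPred_eq]
    rw [← hcast ω]
    simp
  simp_rw [h2]
  rw [tsum_natCast_mul_poisson (by positivity), ENNReal.ofReal_mul hlam, ofReal_measureReal hvol]

theorem IsPoissonProcess.preimage_void (h : IsPoissonProcess μ lam N) (B : Set (ℝ × ℝ)) :
    h.config ⁻¹' (Config.void B) = {ω | (N ω ∩ B).encard = 0} := by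
  ext ω
  simp [config, Config.mem_void, Set.disjoint_iff_inter_eq_empty]

theorem IsPoissonProcess.isPoissonLaw [IsProbabilityMeasure μ] (h : IsPoissonProcess μ lam N)
    (hlam : 0 ≤ lam) :
    IsPoissonLaw lam (μ.map h.config) where
  isProbabilityMeasure := Measure.isProbabilityMeasure_map h.measurable_config.aemeasurable
  void_eq B hB hvol := by
    rw [Measure.map_apply h.measurable_config (Config.measurableSet_void hB), h.preimage_void]
    have := h.count_law B hB hvol 0
    simpa using this
  void_inter A B hA hB hAB := by
    rw [Measure.map_apply h.measurable_config (Config.measurableSet_void hB),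
      Measure.map_apply h.measurable_config (Config.measurableSet_void hA),
      Measure.map_apply h.measurable_config
        ((Config.measurableSet_void hA).inter (Config.measurableSet_void hB)),
      Set.preimage_inter, h.preimage_void, h.preimage_void]
    exact (h.indepFun_counts hA hB hAB).measure_inter_preimage_eq_mul {0} {0}
      (measurableSet_singleton _) (measurableSet_singleton _)
  lintegral_count C B hC hB hCB := by
    -- For bounded `C` the count is finite, so its mean can be read off from the Poisson weights and
    -- factors by independence. Annuli then give arbitrary `C`.
    have key : ∀ C, MeasurableSet C → Disjoint C B → Bornology.IsBounded C →
        ∫⁻ S in Config.void B, Config.count S C ∂(μ.map h.config)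
          = ENNReal.ofReal lam * volume C * μ.map h.config (Config.void B) := by
      intro C hC hCB hb
      have hv := Config.measurableSet_void hB
      rw [setLIntegral_map hv (Config.count.measurable_coe hC) h.measurable_config,
        Measure.map_apply h.measurable_config hv, h.preimage_void]
      have hs : MeasurableSet {ω | (N ω ∩ B).encard = 0} :=
        h.measurable_count B hB (measurableSet_singleton 0)
      rw [← lintegral_indicator hs, ← h.lintegral_encard hlam hC hb,
        ← lintegral_indicator_one hs]
      have hc : ∀ ω, Config.count (h.config ω) C = ((N ω ∩ C).encard : ℝ≥0∞) :=
        fun ω => Config.count_apply _ hC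
      simp_rw [hc]
      have hind := (h.indepFun_counts hC hB hCB).comp (φ := fun k : ℕ∞ => (k : ℝ≥0∞))
        (ψ := ({0} : Set ℕ∞).indicator (1 : ℕ∞ → ℝ≥0∞)) (by fun_prop)
        (measurable_one.indicator (measurableSet_singleton _))
      have := lintegral_mul_eq_lintegral_mul_lintegral_of_indepFun'' (μ := μ)
        ((measurable_from_top (f := fun k : ℕ∞ => (k : ℝ≥0∞))).comp
          (h.measurable_count C hC)).aemeasurable
        ((measurable_one.indicator (measurableSet_singleton _)).comp
          (h.measurable_count B hB)).aemeasurable hind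
      refine Eq.trans (lintegral_congr fun ω => ?_) this
      simp only [Function.comp, Set.indicator, Set.mem_ofPred_eq, Set.mem_singleton_iff,
        Pi.one_apply]
      split_ifs <;> simp
    have hC' : ⋃ j, C ∩ Config.annulus j = C := by
      rw [← Set.inter_iUnion]
      unfold Config.annulus
      rw [iUnion_disjointed, Metric.iUnion_ball_nat, Set.inter_univ]
    have hdisj : Pairwise (Function.onFun Disjoint fun j => C ∩ Config.annulus j) :=
      fun i j hij => (disjoint_disjointed _ hij).mono Set.inter_subset_right
          Set.inter_subset_right
    have hmeas : ∀ j, MeasurableSet (C ∩ Config.annulus j) := fun j =>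
      hC.inter (Config.measurableSet_annulus j)
    conv_lhs => rw [← hC']
    conv_rhs => rw [← hC']
    simp_rw [measure_iUnion hdisj hmeas]
    rw [lintegral_tsum fun j => (Config.count.measurable_coe (hmeas j)).aemeasurable,
      ← ENNReal.tsum_mul_left, ← ENNReal.tsum_mul_right]
    exact tsum_congr fun j => key _ (hmeas j) (hCB.mono_left Set.inter_subset_left)
      ((Config.isBounded_annulus j).subset Set.inter_subset_right)

end ofProcess

namespace IsPoissonLaw
variable {lam : ℝ} {P : Measure Config}

/-- Both measures give a rectangle `void B ×ˢ C` the mass `λ |C \ B| P(void B)`: on `void B` only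
points of `C \ B` are counted, and inserting `y` keeps `B` void exactly when `y ∉ B`. These
rectangles form a generating π-system. -/
theorem mecke_measure (h : IsPoissonLaw lam P) :
    P ⊗ₘ Config.count = ((ENNReal.ofReal lam • (volume : Measure (ℝ × ℝ))).prod P).map
      (fun p => (Config.insert p.1 p.2, p.1)) := by
  have := h.isProbabilityMeasure
  have hmap : Measurable fun p : (ℝ × ℝ) × Config => (Config.insert p.1 p.2, p.1) :=
    Config.measurable_insert.prodMk measurable_fst
  have hrect : ∀ B C, MeasurableSet B → MeasurableSet C →
      (P ⊗ₘ Config.count) (Config.void B ×ˢ C)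
        = ENNReal.ofReal lam * volume (C \ B) * P (Config.void B) := by
    intro B C hB hC
    rw [Measure.compProd_apply_prod (Config.measurableSet_void hB) hC,
      ← h.lintegral_count (C \ B) B (hC.diff hB) hB Set.disjoint_sdiff_left]
    refine setLIntegral_congr_fun (Config.measurableSet_void hB) fun S hS => ?_
    have h0 : Config.count S B = 0 := (Config.count_eq_zero_iff hB).2 hS
    exact (measure_sdiff_null h0).symm
  refine Measure.ext_of_generateFrom_of_iUnion
    (Set.image2 (· ×ˢ ·) Config.voidEvents {s | MeasurableSet s})
    (fun n : ℕ => Set.univ ×ˢ Metric.ball 0 n) ?_ ?_ ?_ ?_ ?_ ?_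
  · refine (generateFrom_eq_prod rfl MeasurableSpace.generateFrom_measurableSet
      Config.isCountablySpanning_voidEvents ?_).symm
    exact isCountablySpanning_measurableSet
  · exact Config.isPiSystem_voidEvents.prod MeasurableSpace.isPiSystem_measurableSet
  · rw [← Set.prod_iUnion, Metric.iUnion_ball_nat, Set.univ_prod_univ]
  · intro n
    have hb : MeasurableSet (Metric.ball (0 : ℝ × ℝ) n) := measurableSet_ball
    exact ⟨_, ⟨∅, .empty, Config.void_empty.symm⟩, _, hb, rfl⟩
  · intro n
    rw [← Config.void_empty, hrect _ _ .empty measurableSet_ball]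
    simp only [Set.sdiff_empty, Config.void_empty, measure_univ, mul_one]
    exact ENNReal.mul_ne_top ENNReal.ofReal_ne_top measure_ball_lt_top.ne
  · rintro _ ⟨_, ⟨B, hB, rfl⟩, C, hC, rfl⟩
    simp only
    rw [hrect B C hB hC, Measure.map_apply hmap ((Config.measurableSet_void hB).prod hC)]
    have : (fun p : (ℝ × ℝ) × Config => (Config.insert p.1 p.2, p.1)) ⁻¹' (Config.void B ×ˢ C)
        = (C \ B) ×ˢ Config.void B := by
      ext p
      simp only [Set.mem_preimage, Set.mem_prod, Config.insert_mem_void, Set.mem_sdiff]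
      tauto
    rw [this, Measure.prod_prod, Measure.smul_apply, smul_eq_mul]

/-- Mecke's formula. -/
theorem mecke (h : IsPoissonLaw lam P) {F : Config × (ℝ × ℝ) → ℝ≥0∞} (hF : Measurable F) :
    ∫⁻ S, ∫⁻ y, F (S, y) ∂(Config.count S) ∂P
      = ENNReal.ofReal lam * ∫⁻ y, ∫⁻ S, F (Config.insert y S, y) ∂P := by
  have := h.isProbabilityMeasure
  have hmap : Measurable fun p : (ℝ × ℝ) × Config => (Config.insert p.1 p.2, p.1) :=
    Config.measurable_insert.prodMk measurable_fst
  rw [← Measure.lintegral_compProd hF, h.mecke_measure, lintegral_map hF hmap,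
    lintegral_prod (fun p : (ℝ × ℝ) × Config => F (Config.insert p.1 p.2, p.1))
      (hF.comp hmap).aemeasurable, lintegral_smul_measure, smul_eq_mul]

theorem void_null (h : IsPoissonLaw lam P) {A : Set (ℝ × ℝ)} (hA : MeasurableSet A)
    (h0 : volume A = 0) : P (Config.void A) = 1 := by
  rw [h.void_eq A hA (by simp [h0])]
  simp [measureReal_def, h0]

/-- Independence is used instead of the formula for void probabilities, so regions of infinite area
are allowed. -/
theorem void_mono (h : IsPoissonLaw lam P) {A B : Set (ℝ × ℝ)} (hA : MeasurableSet A)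
    (hB : MeasurableSet B) (h0 : volume (B \ A) = 0) :
    P (Config.void A) ≤ P (Config.void B) := by
  have h1 := h.void_inter A (B \ A) hA (hB.diff hA) Set.disjoint_sdiff_right
  rw [h.void_null (hB.diff hA) h0, mul_one] at h1
  rw [← h1, ← Config.void_union]
  refine measure_mono fun S hS => ?_
  exact Disjoint.mono_right (by rw [Set.union_sdiff_self]; exact Set.subset_union_right) hS

theorem void_congr (h : IsPoissonLaw lam P) {A B : Set (ℝ × ℝ)} (hA : MeasurableSet A)
    (hB : MeasurableSet B) (h0 : volume (B \ A) = 0) (h1 : volume (A \ B) = 0) :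
    P (Config.void A) = P (Config.void B) :=
  le_antisymm (h.void_mono hA hB h0) (h.void_mono hB hA h1)

end IsPoissonLaw

/-! ### The ancestor as a functional of the configuration. -/

/-- The upper part of the closed `ℓ∞` ball. -/
def closedUpperBall (x : ℝ × ℝ) (r : ℝ) : Set (ℝ × ℝ) := Metric.closedBall x r ∩ upperHalfPlane x.2

theorem mem_closedUpperBall {x y : ℝ × ℝ} {r : ℝ} :
    y ∈ closedUpperBall x r ↔ ‖y - x‖ ≤ r ∧ x.2 < y.2 := by
  simp [closedUpperBall, upperHalfPlane, dist_eq_norm]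

theorem measurableSet_upperHalfPlane (r : ℝ) : MeasurableSet (upperHalfPlane r) :=
  measurableSet_lt measurable_const measurable_snd

theorem measurableSet_closedUpperBall (x : ℝ × ℝ) (r : ℝ) : MeasurableSet (closedUpperBall x r) :=
  measurableSet_closedBall.inter (measurableSet_upperHalfPlane _)

/-- There is a unique nearest point of `S` above `x`. -/
def HasAncestor (x : ℝ × ℝ) (S : Set (ℝ × ℝ)) : Prop := ∃! y, IsNearestAbove x S y

theorem HasAncestor.isNearestAbove {x : ℝ × ℝ} {S : Set (ℝ × ℝ)} (h : HasAncestor x S) :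
    IsNearestAbove x S (ancestor x S) := by
  have h' : ∃! y, IsNearestAbove x S y := h
  have h1 : ancestor x S = h'.choose := dif_pos h'
  rw [h1]
  exact h'.choose_spec.1

theorem ancestor_of_not {x : ℝ × ℝ} {S : Set (ℝ × ℝ)} (h : ¬ HasAncestor x S) :
    ancestor x S = x := dif_neg h

theorem isNearestAbove_congr {x : ℝ × ℝ} {S T : Set (ℝ × ℝ)}
    (h : ∀ y, x.2 < y.2 → (y ∈ S ↔ y ∈ T)) (y : ℝ × ℝ) :
    IsNearestAbove x S y ↔ IsNearestAbove x T y := by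
  unfold IsNearestAbove
  constructor
  · rintro ⟨⟨h1, h2⟩, h3⟩
    exact ⟨⟨(h y h2).1 h1, h2⟩, fun z hz hz2 => h3 z ((h z hz2).2 hz) hz2⟩
  · rintro ⟨⟨h1, h2⟩, h3⟩
    exact ⟨⟨(h y h2).2 h1, h2⟩, fun z hz hz2 => h3 z ((h z hz2).1 hz) hz2⟩

theorem ancestor_congr {x : ℝ × ℝ} {S T : Set (ℝ × ℝ)}
    (h : ∀ y, x.2 < y.2 → (y ∈ S ↔ y ∈ T)) : ancestor x S = ancestor x T := by
  have hiff : HasAncestor x S ↔ HasAncestor x T := by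
    unfold HasAncestor
    simp only [isNearestAbove_congr h]
  by_cases hS : HasAncestor x S
  · have hT := hiff.1 hS
    exact hT.unique ((isNearestAbove_congr h _).1 hS.isNearestAbove) hT.isNearestAbove
  · rw [ancestor_of_not hS, ancestor_of_not (fun hT => hS (hiff.2 hT))]

theorem IsNearestAbove.unique {x y z : ℝ × ℝ} {S : Set (ℝ × ℝ)}
    (hy : S ∩ closedUpperBall x ‖y - x‖ = {y}) (hz : IsNearestAbove x S z) : z = y := by
  have hyS : y ∈ S ∩ closedUpperBall x ‖y - x‖ := by rw [hy]; rfl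
  have : z ∈ S ∩ closedUpperBall x ‖y - x‖ :=
    ⟨hz.1.1, mem_closedUpperBall.2 ⟨hz.2 y hyS.1 (mem_closedUpperBall.1 hyS.2).2, hz.1.2⟩⟩
  rw [hy] at this
  exact this

theorem isNearestAbove_of_inter_eq {x y : ℝ × ℝ} {S : Set (ℝ × ℝ)}
    (hy : S ∩ closedUpperBall x ‖y - x‖ = {y}) : IsNearestAbove x S y := by
  have hyS : y ∈ S ∩ closedUpperBall x ‖y - x‖ := by rw [hy]; rfl
  refine ⟨⟨hyS.1, (mem_closedUpperBall.1 hyS.2).2⟩, fun z hz hz2 => ?_⟩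
  by_contra! hlt
  have : z ∈ S ∩ closedUpperBall x ‖y - x‖ := ⟨hz, mem_closedUpperBall.2 ⟨hlt.le, hz2⟩⟩
  rw [hy] at this
  rw [Set.mem_singleton_iff.1 this] at hlt
  exact lt_irrefl _ hlt

theorem hasAncestor_of_inter_eq {x y : ℝ × ℝ} {S : Set (ℝ × ℝ)}
    (hy : S ∩ closedUpperBall x ‖y - x‖ = {y}) : HasAncestor x S :=
  ⟨y, isNearestAbove_of_inter_eq hy, fun _ hz => IsNearestAbove.unique hy hz⟩

theorem ancestor_of_inter_eq {x y : ℝ × ℝ} {S : Set (ℝ × ℝ)}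
    (hy : S ∩ closedUpperBall x ‖y - x‖ = {y}) : ancestor x S = y :=
  IsNearestAbove.unique hy (hasAncestor_of_inter_eq hy).isNearestAbove

theorem HasAncestor.inter_eq {x : ℝ × ℝ} {S : Set (ℝ × ℝ)} (h : HasAncestor x S) :
    S ∩ closedUpperBall x ‖ancestor x S - x‖ = {ancestor x S} := by
  have h0 := h.isNearestAbove
  refine Set.Subset.antisymm ?_ ?_
  · rintro z ⟨hz, hz2⟩
    rw [mem_closedUpperBall] at hz2
    exact h.unique ⟨⟨hz, hz2.2⟩, fun w hw hw2 => hz2.1.trans (h0.2 w hw hw2)⟩ h0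
  · rintro _ rfl
    exact ⟨h0.1.1, mem_closedUpperBall.2 ⟨le_rfl, h0.1.2⟩⟩

namespace Config

theorem count_eq_one_iff {S : Config} {B : Set (ℝ × ℝ)} {y : ℝ × ℝ} (hB : MeasurableSet B)
    (hyS : y ∈ S.carrier) (hyB : y ∈ B) : count S B = 1 ↔ S.carrier ∩ B = {y} := by
  rw [count_apply S hB, ← ENat.toENNReal_one, ENat.toENNReal_inj, Set.encard_eq_one]
  constructor
  · rintro ⟨z, hz⟩
    have : y ∈ S.carrier ∩ B := ⟨hyS, hyB⟩
    rw [hz] at this ⊢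
    rw [Set.mem_singleton_iff.1 this]
  · exact fun h => ⟨y, h⟩

-- A point `y` is the unique nearest one exactly when it is the only point of the configuration in
-- `C ∩ closedUpperBall x ‖y - x‖`. Functionals of the ancestor thus become integrals against the
-- counting measure, which yields their measurability and makes Mecke's formula applicable.
open Classical in
theorem lintegral_select (S : Config) {x : ℝ × ℝ} {C : Set (ℝ × ℝ)} (hC : MeasurableSet C)
    (hCx : C ⊆ upperHalfPlane x.2) (F : ℝ × ℝ → ℝ≥0∞) :
    ∫⁻ y, (C ∩ {y | count S (C ∩ closedUpperBall x ‖y - x‖) = 1}).indicator F y ∂(count S)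
      = if HasAncestor x (S.carrier ∩ C) then F (ancestor x (S.carrier ∩ C)) else 0 := by
  rw [lintegral_count]
  have key : ∀ y ∈ S.carrier, y ∈ C ∩ {y | count S (C ∩ closedUpperBall x ‖y - x‖) = 1} ↔
      (S.carrier ∩ C) ∩ closedUpperBall x ‖y - x‖ = {y} := by
    intro y hy
    constructor
    · rintro ⟨h1, h2⟩
      have h3 : y ∈ C ∩ closedUpperBall x ‖y - x‖ := ⟨h1, mem_closedUpperBall.2 ⟨le_rfl, hCx h1⟩⟩
      rw [Set.inter_assoc]
      exact (count_eq_one_iff (hC.inter (measurableSet_closedUpperBall _ _)) hy h3).1 h2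
    · intro h
      have hy' : y ∈ S.carrier ∩ C ∩ closedUpperBall x ‖y - x‖ := by rw [h]; rfl
      refine ⟨hy'.1.2, ?_⟩
      rw [Set.inter_assoc] at h
      exact (count_eq_one_iff (hC.inter (measurableSet_closedUpperBall _ _)) hy
        ⟨hy'.1.2, hy'.2⟩).2 h
  split_ifs with h
  · have hm := h.isNearestAbove.1.1
    rw [tsum_eq_single ⟨_, hm.1⟩]
    · rw [Set.indicator_of_mem]
      exact (key _ hm.1).2 h.inter_eq
    · rintro ⟨y, hy⟩ hne
      refine Set.indicator_of_notMem (fun hmem => hne ?_) _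
      exact Subtype.ext (ancestor_of_inter_eq ((key y hy).1 hmem)).symm
  · rw [ENNReal.tsum_eq_zero]
    rintro ⟨y, hy⟩
    exact Set.indicator_of_notMem
      (fun hmem => h (hasAncestor_of_inter_eq ((key y hy).1 hmem))) _

end Config

theorem measurableSet_selected {α : Type*} [MeasurableSpace α] {x : α → ℝ × ℝ}
    (hx : Measurable x) {C : α → Set (ℝ × ℝ)} (hC : MeasurableSet {p : α × (ℝ × ℝ) | p.2 ∈ C p.1}) :
    MeasurableSet {p : (α × Config) × (ℝ × ℝ) | p.2 ∈ C p.1.1 ∩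
      {y | Config.count p.1.2 (C p.1.1 ∩ closedUpperBall (x p.1.1) ‖y - x p.1.1‖) = 1}} := by
  refine MeasurableSet.inter ((measurable_fst.fst.prodMk measurable_snd) hC) ?_
  have hT : MeasurableSet {q : ((α × (ℝ × ℝ)) × Config) × (ℝ × ℝ) | q.2 ∈ C q.1.1.1 ∩
      closedUpperBall (x q.1.1.1) ‖q.1.1.2 - x q.1.1.1‖} := by
    refine MeasurableSet.inter
      ((measurable_fst.fst.fst.prodMk measurable_snd) hC) ?_
    simp only [closedUpperBall, upperHalfPlane]
    refine MeasurableSet.inter (measurableSet_le ?_ ?_) (measurableSet_lt ?_ ?_)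
    all_goals fun_prop
  have h1 := Config.measurable_count_section hT
  have h2 : Measurable fun p : (α × Config) × (ℝ × ℝ) => ((p.1.1, p.2), p.1.2) := by fun_prop
  exact (h1.comp h2) (measurableSet_singleton (1 : ℝ≥0∞))

open Classical in
theorem measurable_ite_hasAncestor {α : Type*} [MeasurableSpace α] {x : α → ℝ × ℝ}
    (hx : Measurable x) {f : (α × Config) × (ℝ × ℝ) → ℝ≥0∞} (hf : Measurable f) :
    Measurable fun p : α × Config => if HasAncestor (x p.1) p.2.carrier then
      f (p, ancestor (x p.1) p.2.carrier) else 0 := by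
  have hC : MeasurableSet {p : α × (ℝ × ℝ) | p.2 ∈ upperHalfPlane (x p.1).2} :=
    measurableSet_lt (hx.comp measurable_fst).snd measurable_snd.snd
  have hm := Config.measurable_lintegral_count (hf.indicator (measurableSet_selected
    (C := fun a => upperHalfPlane (x a).2) hx hC))
  convert hm using 2 with p
  have h := Config.lintegral_select p.2 (x := x p.1)
    (measurableSet_upperHalfPlane (x p.1).2) subset_rfl (fun y => f (p, y))
  have hc : ∀ y, (x p.1).2 < y.2 → (y ∈ p.2.carrier ↔ y ∈ p.2.carrier ∩
      upperHalfPlane (x p.1).2) := fun y hy => ⟨fun h => ⟨h, hy⟩, fun h => h.1⟩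
  have h1 : HasAncestor (x p.1) p.2.carrier ↔
      HasAncestor (x p.1) (p.2.carrier ∩ upperHalfPlane (x p.1).2) := by
    unfold HasAncestor
    simp only [isNearestAbove_congr hc]
  rw [ancestor_congr hc]
  simp only [h1]
  exact h.symm

theorem measurable_ancestor {α : Type*} [MeasurableSpace α] {x : α → ℝ × ℝ}
    (hx : Measurable x) :
    Measurable fun p : α × Config => ancestor (x p.1) p.2.carrier := by
  classical
  have h1 : ∀ A : Set (ℝ × ℝ), MeasurableSet A →
      MeasurableSet {p : α × Config | HasAncestor (x p.1) p.2.carrier ∧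
        ancestor (x p.1) p.2.carrier ∈ A} := by
    intro A hA
    have := (measurable_ite_hasAncestor hx (f := fun p => A.indicator 1 p.2)
      ((measurable_one.indicator hA).comp measurable_snd)) (measurableSet_singleton 1)
    convert this using 1
    ext p
    simp only [Set.mem_ofPred_eq, Set.mem_preimage, Set.mem_singleton_iff]
    by_cases h1 : HasAncestor (x p.1) p.2.carrier <;>
      by_cases h2 : ancestor (x p.1) p.2.carrier ∈ A <;> simp [h1, h2]
  have h2 : MeasurableSet {p : α × Config | HasAncestor (x p.1) p.2.carrier} := by
    simpa using h1 Set.univ .univ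
  intro A hA
  have : (fun p : α × Config => ancestor (x p.1) p.2.carrier) ⁻¹' A =
      {p : α × Config | HasAncestor (x p.1) p.2.carrier ∧ ancestor (x p.1) p.2.carrier ∈ A} ∪
      ({p : α × Config | HasAncestor (x p.1) p.2.carrier}ᶜ ∩ (fun p => x p.1) ⁻¹' A) := by
    ext p
    by_cases h : HasAncestor (x p.1) p.2.carrier
    · simp [h]
    · simp [h, ancestor_of_not h]
  rw [this]
  exact (h1 A hA).union (h2.compl.inter ((hx.comp measurable_fst) hA))

namespace IsPoissonLaw
variable {lam : ℝ} {P : Measure Config}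

open Classical in
/-- The joint law of the ancestor and the configuration. -/
theorem lintegral_ancestor (h : IsPoissonLaw lam P) {x : ℝ × ℝ} {C : Set (ℝ × ℝ)}
    (hC : MeasurableSet C) (hCx : C ⊆ upperHalfPlane x.2) {F : Config × (ℝ × ℝ) → ℝ≥0∞}
    (hF : Measurable F) :
    ∫⁻ S, (if HasAncestor x (S.carrier ∩ C) then F (S, ancestor x (S.carrier ∩ C)) else 0) ∂P
      = ENNReal.ofReal lam * ∫⁻ y in C, ∫⁻ S in
          Config.void ((C ∩ closedUpperBall x ‖y - x‖) \ {y}), F (Config.insert y S, y) ∂P := by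
  have hT : MeasurableSet {p : Config × (ℝ × ℝ) | p.2 ∈ C ∩
      {y | Config.count p.1 (C ∩ closedUpperBall x ‖y - x‖) = 1}} := by
    have h0 := measurableSet_selected (α := Unit) (x := fun _ => x) measurable_const
      (C := fun _ => C) (measurable_snd hC)
    have hm : Measurable fun p : Config × (ℝ × ℝ) => ((((), p.1), p.2) :
        (Unit × Config) × (ℝ × ℝ)) := by fun_prop
    exact hm h0
  have hM := h.mecke (hF.indicator hT)
  have e1 : ∀ S : Config, ∫⁻ y, ({p : Config × (ℝ × ℝ) | p.2 ∈ C ∩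
      {y | Config.count p.1 (C ∩ closedUpperBall x ‖y - x‖) = 1}}).indicator F (S, y)
        ∂(Config.count S) = if HasAncestor x (S.carrier ∩ C) then
          F (S, ancestor x (S.carrier ∩ C)) else 0 := fun S =>
    Config.lintegral_select S hC hCx (fun y => F (S, y))
  simp_rw [e1] at hM
  rw [hM, ← lintegral_indicator hC]
  congr 1
  refine lintegral_congr fun y => ?_
  by_cases hy : y ∈ C
  · rw [Set.indicator_of_mem hy, ← lintegral_indicator (Config.measurableSet_void
      ((hC.inter (measurableSet_closedUpperBall _ _)).diff (measurableSet_singleton _)))]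
    refine lintegral_congr fun S => ?_
    have hyB : y ∈ C ∩ closedUpperBall x ‖y - x‖ := ⟨hy, mem_closedUpperBall.2 ⟨le_rfl, hCx hy⟩⟩
    -- The inserted point is selected exactly when `S` has no other point in the closed ball.
    -- Removing `y` from the void region allows `S` to contain `y` already.
    have : (Config.insert y S, y) ∈ {p : Config × (ℝ × ℝ) | p.2 ∈ C ∩
        {y | Config.count p.1 (C ∩ closedUpperBall x ‖y - x‖) = 1}} ↔
        S ∈ Config.void ((C ∩ closedUpperBall x ‖y - x‖) \ {y}) := by
      have hyS : y ∈ (Config.insert y S).carrier := Set.mem_insert _ _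
      change (y ∈ C ∧ Config.count (Config.insert y S) (C ∩ closedUpperBall x ‖y - x‖) = 1) ↔ _
      rw [and_iff_right hy, Config.count_eq_one_iff
        (hC.inter (measurableSet_closedUpperBall _ _)) hyS hyB, Config.mem_void, Set.disjoint_left]
      simp only [Config.insert, Set.ext_iff, Set.mem_inter_iff, Set.mem_insert_iff,
        Set.mem_singleton_iff, Set.mem_sdiff] at hyB ⊢
      constructor
      · intro h z hz hz'
        exact hz'.2 ((h z).1 ⟨Or.inr hz, hz'.1⟩)
      · intro h z
        constructor
        · rintro ⟨rfl | hz, hz'⟩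
          · rfl
          · by_contra hne; exact h hz ⟨hz', hne⟩
        · rintro rfl; exact ⟨Or.inl rfl, hyB⟩
    by_cases h' : S ∈ Config.void ((C ∩ closedUpperBall x ‖y - x‖) \ {y})
    · rw [Set.indicator_of_mem (this.2 h'), Set.indicator_of_mem h']
    · rw [Set.indicator_of_notMem (fun hh => h' (this.1 hh)), Set.indicator_of_notMem h']
  · rw [Set.indicator_of_notMem hy, ← lintegral_zero (μ := P)]
    exact lintegral_congr fun S => Set.indicator_of_notMem (fun hh => hy hh.1) _

/-- By Mecke's formula, the expected number of points `y` with another point on the sphere through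
`y` is an integral of probabilities that a null set is hit. Hence there are almost surely no ties.
-/
theorem ae_inter_sphere (h : IsPoissonLaw lam P) (x : ℝ × ℝ) :
    ∀ᵐ S ∂P, ∀ y ∈ S.carrier, ∀ z ∈ S.carrier, ‖z - x‖ = ‖y - x‖ → z = y := by
  have := h.isProbabilityMeasure
  have hT : MeasurableSet {q : ((ℝ × ℝ) × Config) × (ℝ × ℝ) |
      q.2 ∈ Metric.sphere x ‖q.1.1 - x‖ \ {q.1.1}} := by
    simp only [Set.mem_sdiff, mem_sphere_iff_norm, Set.mem_singleton_iff]
    refine (measurableSet_eq_fun ?_ ?_).inter (measurableSet_eq_fun ?_ ?_).compl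
    all_goals fun_prop
  have hm : MeasurableSet {p : Config × (ℝ × ℝ) |
      Config.count p.1 (Metric.sphere x ‖p.2 - x‖ \ {p.2}) = 0}ᶜ := by
    have h2 : Measurable fun p : Config × (ℝ × ℝ) => (p.2, p.1) := by fun_prop
    exact (((Config.measurable_count_section hT).comp h2) (measurableSet_singleton 0)).compl
  have hmeas : ∀ y : ℝ × ℝ, MeasurableSet (Metric.sphere x ‖y - x‖ \ {y}) := fun y =>
    Metric.isClosed_sphere.measurableSet.diff (measurableSet_singleton _)
  have hM := h.mecke (measurable_one.indicator hm)
  have h0 : ∀ y, ∫⁻ S, ({p : Config × (ℝ × ℝ) | Config.count p.1 (Metric.sphere x ‖p.2 - x‖ \ {p.2})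
      = 0}ᶜ).indicator (1 : Config × (ℝ × ℝ) → ℝ≥0∞) (Config.insert y S, y) ∂P = 0 := by
    intro y
    have h1 : P (Config.void (Metric.sphere x ‖y - x‖ \ {y})) = 1 :=
      h.void_null (hmeas y) (measure_mono_null Set.sdiff_subset (Measure.addHaar_sphere _ _ _))
    have h2 : ∀ᵐ S ∂P, S ∈ Config.void (Metric.sphere x ‖y - x‖ \ {y}) :=
      (prob_compl_eq_zero_iff (Config.measurableSet_void (hmeas y))).2 h1
    refine (lintegral_congr_ae (g := fun _ => 0) ?_).trans lintegral_zero
    filter_upwards [h2] with S hS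
    have h3 : Config.count (Config.insert y S) (Metric.sphere x ‖y - x‖ \ {y}) = 0 :=
      (Config.count_eq_zero_iff (hmeas y)).2 (Config.insert_mem_void.2 ⟨by simp, hS⟩)
    apply Set.indicator_of_notMem
    exact fun hh => hh h3
  simp_rw [h0] at hM
  rw [lintegral_zero, mul_zero, lintegral_eq_zero_iff] at hM
  · filter_upwards [hM] with S hS y hy z hz hyz
    rw [Config.lintegral_count, Pi.zero_apply, ENNReal.tsum_eq_zero] at hS
    have := hS ⟨y, hy⟩
    rw [Set.indicator_apply_eq_zero] at this
    by_contra hne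
    have hmem : (S, y) ∉ {p : Config × (ℝ × ℝ) |
      Config.count p.1 (Metric.sphere x ‖p.2 - x‖ \ {p.2}) = 0}ᶜ := fun hh => by
        simpa using this hh
    rw [Set.notMem_compl_iff] at hmem
    have hd := (Config.count_eq_zero_iff (hmeas y)).1 hmem
    exact Set.disjoint_left.1 hd hz ⟨mem_sphere_iff_norm.2 hyz, hne⟩
  · have := Config.measurable_lintegral_count (α := Unit)
      (f := fun q => ({p : Config × (ℝ × ℝ) | Config.count p.1 (Metric.sphere x ‖p.2 - x‖ \ {p.2})
      = 0}ᶜ).indicator (1 : Config × (ℝ × ℝ) → ℝ≥0∞) (q.1.2, q.2))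
      ((measurable_one.indicator hm).comp (by fun_prop))
    exact this.comp (measurable_prodMk_left (x := ()))

end IsPoissonLaw

/-- A locally finite set with a point in `C` but without ties has an ancestor in `C`. -/
theorem hasAncestor_of_nonempty {S : Config} {x : ℝ × ℝ} {C : Set (ℝ × ℝ)}
    (hCx : C ⊆ upperHalfPlane x.2) (hne : S ∉ Config.void C)
    (hS : ∀ y ∈ S.carrier, ∀ z ∈ S.carrier, ‖z - x‖ = ‖y - x‖ → z = y) :
    HasAncestor x (S.carrier ∩ C) := by
  obtain ⟨w, hwS, hwC⟩ := Set.not_disjoint_iff.1 hne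
  have hfin : (S.carrier ∩ C ∩ closedUpperBall x ‖w - x‖).Finite :=
    (S.finite_inter (Metric.closedBall x ‖w - x‖) Metric.isBounded_closedBall).subset
      fun z hz => ⟨hz.1.1, hz.2.1⟩
  have hw : w ∈ S.carrier ∩ C ∩ closedUpperBall x ‖w - x‖ :=
    ⟨⟨hwS, hwC⟩, mem_closedUpperBall.2 ⟨le_rfl, hCx hwC⟩⟩
  obtain ⟨y, hy, hmin⟩ := Set.exists_min_image _ (fun z => ‖z - x‖) hfin ⟨w, hw⟩
  have hyn : IsNearestAbove x (S.carrier ∩ C) y := by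
    refine ⟨⟨hy.1, hCx hy.1.2⟩, fun z hz hz2 => ?_⟩
    by_cases hzw : ‖z - x‖ ≤ ‖w - x‖
    · exact hmin z ⟨hz, mem_closedUpperBall.2 ⟨hzw, hz2⟩⟩
    · exact (hmin w hw).trans (not_le.1 hzw).le
  refine ⟨y, hyn, fun z hz => hS y hy.1.1 z hz.1.1.1 ?_⟩
  exact le_antisymm (hz.2 y hyn.1.1 hyn.1.2) (hyn.2 z hz.1.1 hz.1.2)

theorem measurable_ancestor_restrict {α : Type*} [MeasurableSpace α] {x : α → ℝ × ℝ}
    (hx : Measurable x) {C : α → Set (ℝ × ℝ)} (hC : MeasurableSet {p : α × (ℝ × ℝ) | p.2 ∈ C p.1}) :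
    Measurable fun p : α × Config => ancestor (x p.1) (p.2.carrier ∩ C p.1) :=
  (measurable_ancestor hx).comp (measurable_fst.prodMk (Config.measurable_restrict hC))

/-! ### One step from an obstacle: density, overshoot and vertical increment. -/

/-- A possible history set at `x`: it lies at height at most `l` above `x`, and it contains every
point between one of its points and the horizontal line through `x`. -/
structure IsObstacle (x : ℝ × ℝ) (H : Set (ℝ × ℝ)) (l : ℝ) : Prop where
  measurableSet : MeasurableSet H
  nonneg : 0 ≤ l
  le_height : ∀ y ∈ H, y.2 ≤ x.2 + l
  downward : ∀ y ∈ H, ∀ t, x.2 < t → t ≤ y.2 → (y.1, t) ∈ H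

theorem IsObstacle.mono {x : ℝ × ℝ} {H : Set (ℝ × ℝ)} {l m : ℝ} (h : IsObstacle x H l)
    (hlm : l ≤ m) : IsObstacle x H m :=
  ⟨h.measurableSet, h.nonneg.trans hlm, fun y hy => (h.le_height y hy).trans (by linarith),
    h.downward⟩

theorem closedUpperBall_eq (x : ℝ × ℝ) (r : ℝ) :
    closedUpperBall x r = Set.Icc (x.1 - r) (x.1 + r) ×ˢ Set.Ioc x.2 (x.2 + r) := by
  ext y
  rw [mem_closedUpperBall, Prod.norm_def, max_le_iff]
  simp only [Prod.fst_sub, Prod.snd_sub, Real.norm_eq_abs, abs_le, Set.mem_prod, Set.mem_Icc,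
    Set.mem_Ioc]
  constructor
  · rintro ⟨⟨⟨h1, h2⟩, h3, h4⟩, h5⟩; refine ⟨⟨?_, ?_⟩, ?_, ?_⟩ <;> linarith
  · rintro ⟨⟨h1, h2⟩, h3, h4⟩; refine ⟨⟨⟨?_, ?_⟩, ?_, ?_⟩, ?_⟩ <;> linarith

theorem volume_closedUpperBall (x : ℝ × ℝ) {r : ℝ} (hr : 0 ≤ r) :
    volume (closedUpperBall x r) = ENNReal.ofReal (2 * r ^ 2) := by
  rw [closedUpperBall_eq, Measure.volume_eq_prod, Measure.prod_prod, Real.volume_Icc,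
    Real.volume_Ioc, ← ENNReal.ofReal_mul (by linarith)]
  congr 1; ring

namespace IsPoissonLaw
variable {lam : ℝ} {P : Measure Config} {x : ℝ × ℝ} {H : Set (ℝ × ℝ)} {l : ℝ}

/-- The box of width `2 * r` between the heights `l` and `r` above `x` lies in the ball and above
the obstacle. -/
theorem void_free_le (h : IsPoissonLaw lam P) (hH : IsObstacle x H l) {r : ℝ} (hr : l ≤ r) :
    P (Config.void ((upperHalfPlane x.2 \ H) ∩ closedUpperBall x r))
      ≤ ENNReal.ofReal (Real.exp (-(lam * (2 * r * (r - l))))) := by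
  have hl := hH.nonneg
  set B : Set (ℝ × ℝ) := Set.Icc (x.1 - r) (x.1 + r) ×ˢ Set.Ioc (x.2 + l) (x.2 + r) with hBdef
  have hB : MeasurableSet B := measurableSet_Icc.prod measurableSet_Ioc
  have hvol : volume B = ENNReal.ofReal (2 * r * (r - l)) := by
    rw [hBdef, Measure.volume_eq_prod, Measure.prod_prod, Real.volume_Icc, Real.volume_Ioc,
      ← ENNReal.ofReal_mul (by linarith)]
    congr 1; ring
  have hsub : B ⊆ (upperHalfPlane x.2 \ H) ∩ closedUpperBall x r := by
    rintro y ⟨hy1, hy2⟩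
    have h1 : x.2 < y.2 := by linarith [hy2.1]
    refine ⟨⟨h1, fun hyH => ?_⟩, ?_⟩
    · have := hH.le_height y hyH
      linarith [hy2.1]
    · rw [closedUpperBall_eq]; exact ⟨hy1, h1, hy2.2⟩
  refine (measure_mono fun S hS => Disjoint.mono_right hsub hS).trans (le_of_eq (?_ : P (Config.void B) = _))
  rw [h.void_eq B hB (by simp [hvol]), measureReal_def, hvol, ENNReal.toReal_ofReal
    (mul_nonneg (by linarith) (by linarith))]

theorem ae_hasAncestor (h : IsPoissonLaw lam P) (hlam : 0 < lam) (hH : IsObstacle x H l) :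
    ∀ᵐ S ∂P, HasAncestor x (S.carrier ∩ (upperHalfPlane x.2 \ H)) := by
  have hsub : upperHalfPlane x.2 \ H ⊆ upperHalfPlane x.2 := Set.sdiff_subset
  have h0 : P (Config.void (upperHalfPlane x.2 \ H)) = 0 := by
    have hlim : Filter.Tendsto (fun n : ℕ =>
        ENNReal.ofReal (Real.exp (-(lam * (n : ℝ))))) Filter.atTop (nhds 0) := by
      rw [← ENNReal.ofReal_zero]
      refine ENNReal.tendsto_ofReal (Real.tendsto_exp_atBot.comp ?_)
      exact Filter.tendsto_neg_atTop_atBot.comp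
        (tendsto_natCast_atTop_atTop.const_mul_atTop hlam)
    refine le_antisymm (ge_of_tendsto hlim ?_) zero_le
    filter_upwards with n
    have hl := hH.nonneg
    have hn : (0 : ℝ) ≤ n := n.cast_nonneg
    have h1 : l ≤ l + 1 + n := by linarith
    calc P (Config.void (upperHalfPlane x.2 \ H))
        ≤ P (Config.void ((upperHalfPlane x.2 \ H) ∩ closedUpperBall x (l + 1 + n))) :=
          measure_mono fun S hS => Disjoint.mono_right Set.inter_subset_left hS
      _ ≤ _ := h.void_free_le hH h1
      _ ≤ _ := by
          refine ENNReal.ofReal_le_ofReal (Real.exp_le_exp.2 (neg_le_neg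
            (mul_le_mul_of_nonneg_left ?_ hlam.le)))
          nlinarith
  filter_upwards [h.ae_inter_sphere x, measure_eq_zero_iff_ae_notMem.1 h0] with S h1 h2
  exact hasAncestor_of_nonempty hsub h2 h1

/-- The density of the ancestor. -/
theorem lintegral_comp_ancestor (h : IsPoissonLaw lam P) (hlam : 0 < lam)
    (hH : IsObstacle x H l) {f : ℝ × ℝ → ℝ≥0∞} (hf : Measurable f) :
    ∫⁻ S, f (ancestor x (S.carrier ∩ (upperHalfPlane x.2 \ H))) ∂P
      = ENNReal.ofReal lam * ∫⁻ y in upperHalfPlane x.2 \ H,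
          f y * P (Config.void ((upperHalfPlane x.2 \ H) ∩ closedUpperBall x ‖y - x‖)) := by
  classical
  have hC : MeasurableSet (upperHalfPlane x.2 \ H) :=
    (measurableSet_upperHalfPlane _).diff hH.measurableSet
  have hM := h.lintegral_ancestor hC Set.sdiff_subset (F := fun p => f p.2)
    (hf.comp measurable_snd)
  have e1 : ∫⁻ S, f (ancestor x (S.carrier ∩ (upperHalfPlane x.2 \ H))) ∂P =
      ∫⁻ S, (if HasAncestor x (S.carrier ∩ (upperHalfPlane x.2 \ H)) then
        f (ancestor x (S.carrier ∩ (upperHalfPlane x.2 \ H))) else 0) ∂P := by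
    refine lintegral_congr_ae ?_
    filter_upwards [h.ae_hasAncestor hlam hH] with S hS
    rw [if_pos hS]
  rw [e1, hM]
  congr 1
  refine lintegral_congr fun y => ?_
  have hB := hC.inter (measurableSet_closedUpperBall x ‖y - x‖)
  change ∫⁻ S in _, f y ∂P = _
  rw [setLIntegral_const]
  congr 1
  refine h.void_congr (hB.diff (measurableSet_singleton y)) hB ?_ ?_
  · exact measure_mono_null (t := {y}) (fun z hz => by
      by_contra hne; exact hz.2 ⟨hz.1, hne⟩) (measure_singleton y)
  · rw [Set.sdiff_eq_empty.2 Set.sdiff_subset, measure_empty]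

theorem measurable_ancestor_free (hH : IsObstacle x H l) :
    Measurable fun S : Config => ancestor x (S.carrier ∩ (upperHalfPlane x.2 \ H)) := by
  have hC : MeasurableSet {p : Unit × (ℝ × ℝ) | p.2 ∈ upperHalfPlane x.2 \ H} :=
    measurable_snd ((measurableSet_upperHalfPlane _).diff hH.measurableSet)
  exact (measurable_ancestor_restrict (x := fun _ => x) measurable_const
    (C := fun _ => upperHalfPlane x.2 \ H) hC).comp (measurable_prodMk_left (x := ()))

theorem measure_lt_norm_ancestor_le (h : IsPoissonLaw lam P) (hlam : 0 < lam)
    (hH : IsObstacle x H l) {r : ℝ} (hr : l ≤ r) :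
    P {S | r < ‖ancestor x (S.carrier ∩ (upperHalfPlane x.2 \ H)) - x‖}
      ≤ ENNReal.ofReal (Real.exp (-(lam * (2 * r * (r - l))))) := by
  refine le_trans (measure_mono_ae ?_) (h.void_free_le hH hr)
  filter_upwards [h.ae_hasAncestor hlam hH] with S hS hSr
  refine Set.disjoint_left.2 fun z hz hz' => ?_
  rw [Set.mem_inter_iff, mem_closedUpperBall] at hz'
  have := hS.isNearestAbove.2 z ⟨hz, hz'.1⟩ hz'.2.2
  exact absurd (hSr : r < _) (not_lt.2 (this.trans hz'.2.1))

/-- Exponential moments of the overshoot of a step above the height of the obstacle. -/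
theorem lintegral_exp_overshoot_le (h : IsPoissonLaw lam P) (hlam : 0 < lam)
    (hH : IsObstacle x H l) (hl : 1 < 2 * lam * l) :
    ∫⁻ S, ENNReal.ofReal (Real.exp
        (max (‖ancestor x (S.carrier ∩ (upperHalfPlane x.2 \ H)) - x‖ - l) 0)) ∂P
      ≤ ENNReal.ofReal (1 + 1 / (2 * lam * l - 1)) := by
  have := h.isProbabilityMeasure
  set f : Config → ℝ := fun S =>
    max (‖ancestor x (S.carrier ∩ (upperHalfPlane x.2 \ H)) - x‖ - l) 0 with hfdef
  have hfm : Measurable f := by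
    have := measurable_ancestor_free hH
    fun_prop
  have hf0 : ∀ S, 0 ≤ f S := fun S => le_max_right _ _
  have hl0 := hH.nonneg
  have hlc := lintegral_comp_eq_lintegral_meas_lt_mul P (f := f) (g := Real.exp)
    (Filter.Eventually.of_forall hf0) hfm.aemeasurable
    (fun t _ => (Real.continuous_exp.intervalIntegrable _ _))
    (Filter.Eventually.of_forall fun t => (Real.exp_pos t).le)
  have hc : 0 < 2 * lam * l - 1 := by linarith
  have hbound : ∫⁻ t in Set.Ioi (0 : ℝ), P {S | t < f S} * ENNReal.ofReal (Real.exp t)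
      ≤ ENNReal.ofReal (1 / (2 * lam * l - 1)) := by
    have h1 : ∫⁻ t in Set.Ioi (0 : ℝ), P {S | t < f S} * ENNReal.ofReal (Real.exp t)
        ≤ ∫⁻ t in Set.Ioi (0 : ℝ), ENNReal.ofReal (Real.exp (-(2 * lam * l - 1) * t)) := by
      refine setLIntegral_mono' measurableSet_Ioi fun t ht => ?_
      have ht' : 0 < t := ht
      have h2 : P {S | t < f S} ≤
          ENNReal.ofReal (Real.exp (-(lam * (2 * (l + t) * ((l + t) - l))))) := by
        refine le_trans (measure_mono fun S hS => ?_)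
          (h.measure_lt_norm_ancestor_le hlam hH (r := l + t) (by linarith))
        have hS' : t < f S := hS
        rw [hfdef, lt_max_iff] at hS'
        rcases hS' with hS' | hS'
        · change l + t < _
          linarith
        · exact absurd hS' (not_lt.2 ht'.le)
      refine (mul_le_mul_left h2 _).trans ?_
      rw [← ENNReal.ofReal_mul (Real.exp_pos _).le, ← Real.exp_add]
      refine ENNReal.ofReal_le_ofReal (Real.exp_le_exp.2 ?_)
      -- The exponent is `-2 λ (l + t) t + t`; dropping `-2 λ t ^ 2` leaves the linear rate `2 λ l -
      -- 1`.
      nlinarith [mul_pos hlam (mul_pos ht' ht')]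
    refine h1.trans (le_of_eq ?_)
    rw [← ofReal_integral_eq_lintegral_ofReal]
    · rw [integral_exp_mul_Ioi (by linarith) 0]
      rw [mul_zero, Real.exp_zero, neg_div_neg_eq]
    · exact integrableOn_exp_mul_Ioi (by linarith) 0
    · exact Filter.Eventually.of_forall fun t => (Real.exp_pos _).le
  have hpt : ∀ S, ENNReal.ofReal (Real.exp (f S))
      = 1 + ENNReal.ofReal (∫ t in (0 : ℝ)..f S, Real.exp t) := by
    intro S
    rw [integral_exp, Real.exp_zero, ← ENNReal.ofReal_one, ← ENNReal.ofReal_add zero_le_one]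
    · congr 1; ring
    · have := Real.one_le_exp (hf0 S); linarith
  change ∫⁻ S, ENNReal.ofReal (Real.exp (f S)) ∂P ≤ _
  rw [lintegral_congr hpt, lintegral_add_left measurable_const, lintegral_const, measure_univ, mul_one, hlc,
    ENNReal.ofReal_add zero_le_one (by positivity), ENNReal.ofReal_one]
  gcongr

/-- The vertical increment of a step is not small with probability at least `1 / 4`. -/
theorem quarter_le_measure_height (h : IsPoissonLaw lam P) (hlam : 0 < lam)
    (hH : IsObstacle x H l) {ε : ℝ} (hε : 0 < ε) (hεlam : lam * (8 * ε ^ 2) ≤ 1 / 2) :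
    ENNReal.ofReal (1 / 4) ≤
      P {S | ε ≤ (ancestor x (S.carrier ∩ (upperHalfPlane x.2 \ H))).2 - x.2} := by
  have := h.isProbabilityMeasure
  set C := upperHalfPlane x.2 \ H with hCdef
  have hC : MeasurableSet C := (measurableSet_upperHalfPlane _).diff hH.measurableSet
  set A : Set (ℝ × ℝ) := {y | ε ≤ y.2 - x.2} with hAdef
  have hA : MeasurableSet A := measurableSet_le measurable_const (by fun_prop)
  set q : ℝ → ℝ≥0∞ := fun r => P (Config.void (C ∩ closedUpperBall x r)) with hq
  have hanc := measurable_ancestor_free hH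
  have hPA : P {S | ε ≤ (ancestor x (S.carrier ∩ C)).2 - x.2}
      = ENNReal.ofReal lam * ∫⁻ y, (C ∩ A).indicator (fun y => q ‖y - x‖) y := by
    have h1 := h.lintegral_comp_ancestor hlam hH (f := A.indicator 1) (measurable_one.indicator hA)
    have h2 : P {S | ε ≤ (ancestor x (S.carrier ∩ C)).2 - x.2} =
        ∫⁻ S, A.indicator 1 (ancestor x (S.carrier ∩ C)) ∂P :=
      (lintegral_indicator_one (μ := P) (hanc hA)).symm
    rw [← hCdef] at h1
    rw [h2, h1, ← lintegral_indicator hC]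
    congr 1
    refine lintegral_congr fun y => ?_
    by_cases hyC : y ∈ C <;> by_cases hyA : y ∈ A <;> simp [hyC, hyA, hq]
  have h1 := h.lintegral_comp_ancestor hlam hH (f := 1) measurable_one
  simp only [Pi.one_apply, lintegral_one, measure_univ, one_mul] at h1
  set D := closedUpperBall x (2 * ε) with hD
  set T := fun y => (C ∩ A).indicator (fun y => q ‖y - x‖) y with hT
  -- The density of the ancestor at `y` depends only on `‖y - x‖`. A low point outside `D` is far in
  -- the horizontal direction, so raising it by `ε` does not change this norm. The raised point
  -- stays free, as otherwise `y` would lie in the obstacle by `downward`. Low points outside `D`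
  -- therefore carry at most as much mass as high ones.
  have hpt : ∀ y, C.indicator (fun y => q ‖y - x‖) y ≤
      D.indicator 1 y + (T y + T (y + (0, ε))) := by
    intro y
    by_cases hyC : y ∈ C
    · rw [Set.indicator_of_mem hyC]
      by_cases hyA : y ∈ A
      · have : T y = q ‖y - x‖ := Set.indicator_of_mem (show y ∈ C ∩ A from ⟨hyC, hyA⟩) _
        rw [this, add_left_comm]
        exact le_self_add
      · by_cases hyD : y ∈ D
        · rw [Set.indicator_of_mem hyD]
          exact prob_le_one.trans le_self_add
        · have hy2 : x.2 < y.2 := hyC.1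
          have hyA' : y.2 - x.2 < ε := not_le.1 hyA
          have hnorm : 2 * ε < ‖y - x‖ := by
            by_contra! hle
            exact hyD (mem_closedUpperBall.2 ⟨hle, hy2⟩)
          rw [Prod.norm_def, Prod.fst_sub, Prod.snd_sub, Real.norm_eq_abs, Real.norm_eq_abs,
            abs_of_pos (sub_pos.2 hy2)] at hnorm
          have hfst : 2 * ε < |y.1 - x.1| := by
            rcases lt_max_iff.1 hnorm with h | h
            · exact h
            · linarith
          have hne : ‖y + (0, ε) - x‖ = ‖y - x‖ := by
            rw [Prod.norm_def, Prod.norm_def]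
            simp only [Prod.fst_sub, Prod.snd_sub, Prod.fst_add, Prod.snd_add, Real.norm_eq_abs,
              add_zero]
            rw [max_eq_left, max_eq_left]
            · rw [abs_of_pos (sub_pos.2 hy2)]; linarith
            · rw [abs_of_pos (by linarith)]; linarith
          have hmem : y + (0, ε) ∈ C ∩ A := by
            refine ⟨⟨?_, fun hyH => hyC.2 ?_⟩, ?_⟩
            · change x.2 < y.2 + ε; linarith
            · have := hH.downward _ hyH y.2 hy2 (by simp [hε.le])
              simpa using this
            · change ε ≤ y.2 + ε - x.2; linarith
          have : T (y + (0, ε)) = q ‖y - x‖ := by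
            rw [hT]; simp only; rw [Set.indicator_of_mem hmem, hne]
          rw [this, ← add_assoc]
          exact le_add_self
    · rw [Set.indicator_of_notMem hyC]
      exact zero_le
  have hqm : Measurable q := by
    have hanti : Antitone q := fun r s hrs => measure_mono fun S hS => by
      refine Disjoint.mono_right (Set.inter_subset_inter_right _ ?_) hS
      exact fun z hz => mem_closedUpperBall.2
        ⟨(mem_closedUpperBall.1 hz).1.trans hrs, (mem_closedUpperBall.1 hz).2⟩
    exact hanti.measurable
  have hTm : Measurable T := (hqm.comp (by fun_prop)).indicator (hC.inter hA)
  have hDm : MeasurableSet D := measurableSet_closedUpperBall _ _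
  have hint : ∫⁻ y in C, q ‖y - x‖ ≤
      ENNReal.ofReal (8 * ε ^ 2) + ((∫⁻ y, T y) + ∫⁻ y, T y) := by
    rw [← lintegral_indicator hC]
    refine (lintegral_mono hpt).trans (le_of_eq ?_)
    rw [lintegral_add_left (measurable_one.indicator hDm), lintegral_add_left hTm,
      lintegral_add_right_eq_self T, lintegral_indicator_one hDm, hD,
      volume_closedUpperBall x (by linarith)]
    congr 2; ring
  -- The total mass is at most `λ |D| ≤ 1 / 2` plus twice the probability in question.
  have hle : (1 : ℝ≥0∞) ≤ ENNReal.ofReal (1 / 2) + (P {S | ε ≤ (ancestor x (S.carrier ∩ C)).2 - x.2}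
      + P {S | ε ≤ (ancestor x (S.carrier ∩ C)).2 - x.2}) := by
    calc (1 : ℝ≥0∞) = ENNReal.ofReal lam * ∫⁻ y in C, q ‖y - x‖ := h1
      _ ≤ ENNReal.ofReal lam * (ENNReal.ofReal (8 * ε ^ 2) + ((∫⁻ y, T y) + ∫⁻ y, T y)) := by
        gcongr
      _ = ENNReal.ofReal (lam * (8 * ε ^ 2)) + (P {S | ε ≤ (ancestor x (S.carrier ∩ C)).2 - x.2}
      + P {S | ε ≤ (ancestor x (S.carrier ∩ C)).2 - x.2}) := by
        rw [mul_add, mul_add, ← hPA, ENNReal.ofReal_mul hlam.le]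
      _ ≤ _ := by gcongr
  set p := P {S | ε ≤ (ancestor x (S.carrier ∩ C)).2 - x.2}
  have hp : p ≠ ⊤ := measure_ne_top _ _
  rw [← ENNReal.ofReal_toReal hp] at hle ⊢
  rw [← ENNReal.ofReal_add (by positivity) (by positivity), ← ENNReal.ofReal_add (by positivity)
    (by positivity), ← ENNReal.ofReal_one, ENNReal.ofReal_le_ofReal_iff (by positivity)] at hle
  exact ENNReal.ofReal_le_ofReal (by linarith)

/-- With a probability bounded below, a step passes vertically beyond an obstacle of bounded
height. -/
theorem le_measure_vertical_step (h : IsPoissonLaw lam P) (hlam : 0 < lam)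
    (hH : IsObstacle x H l) (hl : 0 < l) :
    ENNReal.ofReal (lam * (2 * l) * Real.exp (-(lam * (2 * (l + 1) ^ 2)))) ≤
      P {S | max l ‖ancestor x (S.carrier ∩ (upperHalfPlane x.2 \ H)) - x‖
        ≤ (ancestor x (S.carrier ∩ (upperHalfPlane x.2 \ H))).2 - x.2} := by
  set C := upperHalfPlane x.2 \ H with hCdef
  have hC : MeasurableSet C := (measurableSet_upperHalfPlane _).diff hH.measurableSet
  -- In this box above the obstacle the vertical distance to `x` exceeds `l` and dominates the
  -- horizontal one. Its area is `2 * l`, and the density there is at least `λ` times the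
  -- probability that the whole upper ball of radius `l + 1` is void.
  set B : Set (ℝ × ℝ) := Set.Ioo (x.1 - l) (x.1 + l) ×ˢ Set.Ioo (x.2 + l) (x.2 + l + 1) with hBdef
  have hB : MeasurableSet B := measurableSet_Ioo.prod measurableSet_Ioo
  have hvol : volume B = ENNReal.ofReal (2 * l) := by
    rw [hBdef, Measure.volume_eq_prod, Measure.prod_prod, Real.volume_Ioo, Real.volume_Ioo,
      ← ENNReal.ofReal_mul (by linarith)]
    congr 1; ring
  have hnorm : ∀ y ∈ B, ‖y - x‖ = y.2 - x.2 := by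
    rintro y ⟨⟨h1, h2⟩, h3, h4⟩
    rw [Prod.norm_def, Prod.fst_sub, Prod.snd_sub, Real.norm_eq_abs, Real.norm_eq_abs,
      abs_of_pos (by linarith : 0 < y.2 - x.2), max_eq_right]
    rw [abs_le]; constructor <;> linarith
  have hBC : B ⊆ C := by
    rintro y ⟨⟨h1, h2⟩, h3, h4⟩
    refine ⟨(by linarith : x.2 < y.2), fun hyH => ?_⟩
    have := hH.le_height y hyH
    linarith
  have hBm : Measurable (B.indicator (1 : ℝ × ℝ → ℝ≥0∞)) := measurable_one.indicator hB
  have hd := h.lintegral_comp_ancestor hlam hH hBm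
  have hle : ∫⁻ S, B.indicator 1 (ancestor x (S.carrier ∩ C)) ∂P ≤
      P {S | max l ‖ancestor x (S.carrier ∩ C) - x‖ ≤ (ancestor x (S.carrier ∩ C)).2 - x.2} := by
    have h2 : ∫⁻ S, B.indicator 1 (ancestor x (S.carrier ∩ C)) ∂P =
        P ((fun S : Config => ancestor x (S.carrier ∩ C)) ⁻¹' B) := by
      rw [← lintegral_indicator_one (measurable_ancestor_free hH hB)]
      rfl
    rw [h2]
    refine measure_mono fun S hS => ?_
    have hS' : ancestor x (S.carrier ∩ C) ∈ B := hS
    change max l _ ≤ _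
    rw [hnorm _ hS']
    exact max_le (by linarith [hS'.2.1]) le_rfl
  refine le_trans ?_ hle
  rw [hd]
  have hbound : ∀ y ∈ B, ENNReal.ofReal (Real.exp (-(lam * (2 * (l + 1) ^ 2)))) ≤
      P (Config.void (C ∩ closedUpperBall x ‖y - x‖)) := by
    intro y hy
    have hr : ‖y - x‖ ≤ l + 1 := by
      rw [hnorm y hy]; linarith [hy.2.2]
    have hv := volume_closedUpperBall x (r := l + 1) (by linarith)
    have := h.void_eq (closedUpperBall x (l + 1)) (measurableSet_closedUpperBall _ _)
      (by rw [hv]; exact ENNReal.ofReal_ne_top)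
    rw [measureReal_def, hv, ENNReal.toReal_ofReal (by positivity)] at this
    rw [← this]
    refine measure_mono fun S hS => Disjoint.mono_right ?_ hS
    exact fun z hz => mem_closedUpperBall.2
        ⟨(mem_closedUpperBall.1 hz.2).1.trans hr, (mem_closedUpperBall.1 hz.2).2⟩
  calc ENNReal.ofReal (lam * (2 * l) * Real.exp (-(lam * (2 * (l + 1) ^ 2))))
      = ENNReal.ofReal lam * ∫⁻ y in B,
          ENNReal.ofReal (Real.exp (-(lam * (2 * (l + 1) ^ 2)))) := by
        rw [setLIntegral_const, hvol, ENNReal.ofReal_mul (by positivity),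
          ENNReal.ofReal_mul hlam.le]
        ring
    _ ≤ ENNReal.ofReal lam * ∫⁻ y in B, B.indicator 1 y *
          P (Config.void (C ∩ closedUpperBall x ‖y - x‖)) := by
        gcongr 1
        refine setLIntegral_mono' hB fun y hy => ?_
        rw [Set.indicator_of_mem hy, Pi.one_apply, one_mul]
        exact hbound y hy
    _ ≤ _ := by
        gcongr 1
        exact lintegral_mono_set hBC

end IsPoissonLaw

/-! ### The drift of the Lyapunov function. -/

/-- The height of the history set above the new position `y`, if it was `l` above the old position
`x`. -/
def nextHeight (l : ℝ) (x y : ℝ × ℝ) : ℝ := max l ‖x - y‖ - (y.2 - x.2)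

/-- The Lyapunov function of the height of the history set, killed at zero. -/
def lyapunov (η t : ℝ) : ℝ≥0∞ := if t ≤ 0 then 0 else ENNReal.ofReal (1 + η * Real.exp t)

theorem measurable_lyapunov (η : ℝ) : Measurable (lyapunov η) :=
  Measurable.ite measurableSet_Iic measurable_const (by fun_prop)

theorem lyapunov_le {η : ℝ} (hη : 0 ≤ η) (t : ℝ) :
    lyapunov η t ≤ 1 + ENNReal.ofReal (η * Real.exp t) := by
  unfold lyapunov
  split_ifs
  · exact zero_le
  · rw [ENNReal.ofReal_add zero_le_one (by positivity), ENNReal.ofReal_one]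

theorem snd_sub_le_norm (x y : ℝ × ℝ) : y.2 - x.2 ≤ ‖y - x‖ :=
  (le_abs_self _).trans (norm_snd_le (y - x))

theorem le_ancestor_snd (x : ℝ × ℝ) (S : Set (ℝ × ℝ)) : x.2 ≤ (ancestor x S).2 := by
  by_cases h : HasAncestor x S
  · exact h.isNearestAbove.1.2.le
  · rw [ancestor_of_not h]

theorem exists_step_constants {lam : ℝ} (hlam : 0 < lam) : ∃ ε κ L : ℝ, 0 < ε ∧ 0 < κ ∧ κ < 1 ∧
    0 < L ∧ lam * (8 * ε ^ 2) ≤ 1 / 2 ∧ 2 * κ = (1 - Real.exp (-ε)) / 4 ∧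
    ∀ l, L ≤ l → 1 < 2 * lam * l ∧ 1 / (2 * lam * l - 1) ≤ κ := by
  set ε := min 1 (1 / (16 * lam)) with hε
  have hε0 : 0 < ε := lt_min one_pos (by positivity)
  have hε1 : ε ≤ 1 := min_le_left _ _
  have hε2 : ε * (16 * lam) ≤ 1 := by
    rw [← le_div_iff₀ (by positivity)]; exact min_le_right _ _
  set κ := (1 - Real.exp (-ε)) / 8 with hκ
  have hexp : Real.exp (-ε) < 1 := by simpa using hε0
  have hκ0 : 0 < κ := by rw [hκ]; linarith
  have hκ1 : κ < 1 := by rw [hκ]; linarith [Real.exp_pos (-ε)]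
  -- The threshold `L` solves `2 λ L - 1 = 1 / κ`, which makes the mean excess of the exponential
  -- overshoot at most `κ` from there on.
  refine ⟨ε, κ, (1 + 1 / κ) / (2 * lam), hε0, hκ0, hκ1, by positivity, by nlinarith,
    by rw [hκ]; ring, fun l hl => ?_⟩
  rw [div_le_iff₀ (by positivity)] at hl
  have h1 : 1 / κ ≤ 2 * lam * l - 1 := by linarith
  have h2 : 0 < 1 / κ := by positivity
  refine ⟨by linarith, ?_⟩
  rw [div_le_iff₀ (by linarith)]
  rw [div_le_iff₀ hκ0] at h1
  linarith

namespace IsPoissonLaw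
variable {lam : ℝ} {P : Measure Config} {x : ℝ × ℝ} {H : Set (ℝ × ℝ)} {l : ℝ}

/-- With overshoot `O` and vertical increment `D`, the height changes by `O - D`. The mean of `exp
O` is at most `1 + κ` and that of `1 - exp (-D)` is at least `2 * κ`, which bounds the mean of `exp
(O - D)` by `1 - κ`. -/
theorem lintegral_lyapunov_le_of_high (h : IsPoissonLaw lam P) (hlam : 0 < lam)
    (hH : IsObstacle x H l) {ε κ η : ℝ} (hε : 0 < ε) (hεlam : lam * (8 * ε ^ 2) ≤ 1 / 2)
    (hκε : 2 * κ = (1 - Real.exp (-ε)) / 4) (hκ0 : 0 < κ) (hκ1 : κ < 1) (hη : 0 < η)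
    (hl : 1 < 2 * lam * l) (hlκ : 1 / (2 * lam * l - 1) ≤ κ) :
    ∫⁻ S, lyapunov η (nextHeight l x (ancestor x (S.carrier ∩ (upperHalfPlane x.2 \ H)))) ∂P
      ≤ ENNReal.ofReal (1 + η * Real.exp l * (1 - κ)) := by
  have := h.isProbabilityMeasure
  have hanc := measurable_ancestor_free hH
  set a : Config → ℝ × ℝ := fun S => ancestor x (S.carrier ∩ (upperHalfPlane x.2 \ H)) with ha
  have hD : ∀ S, 0 ≤ (a S).2 - x.2 := fun S => sub_nonneg.2 (le_ancestor_snd _ _)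
  set X : Config → ℝ≥0∞ := fun S =>
    ENNReal.ofReal (Real.exp (max (‖a S - x‖ - l) 0 - ((a S).2 - x.2))) with hX
  set Y : Config → ℝ≥0∞ := fun S => ENNReal.ofReal (1 - Real.exp (-((a S).2 - x.2))) with hY
  have hXm : Measurable X := by fun_prop
  have hYm : Measurable Y := by fun_prop
  -- Pointwise this is `(exp O - 1) * (1 - exp (-D)) ≥ 0`, so no independence of `O` and `D` is
  -- needed.
  have hXY : ∫⁻ S, X S ∂P + ∫⁻ S, Y S ∂P ≤ ENNReal.ofReal (1 + κ) := by
    rw [← lintegral_add_left hXm]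
    refine le_trans (lintegral_mono fun S => ?_) ((h.lintegral_exp_overshoot_le hlam hH hl).trans
      (ENNReal.ofReal_le_ofReal (by linarith)))
    have h1 : Real.exp (-((a S).2 - x.2)) ≤ 1 := Real.exp_le_one_iff.2 (by linarith [hD S])
    have h2 : 1 ≤ Real.exp (max (‖a S - x‖ - l) 0) := Real.one_le_exp (le_max_right _ _)
    simp only [hX, hY]
    rw [← ENNReal.ofReal_add (Real.exp_pos _).le (by linarith)]
    refine ENNReal.ofReal_le_ofReal ?_
    rw [sub_eq_add_neg, Real.exp_add]
    nlinarith
  have hYl : ENNReal.ofReal (2 * κ) ≤ ∫⁻ S, Y S ∂P := by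
    have h1 : 0 ≤ 1 - Real.exp (-ε) := by linarith
    calc ENNReal.ofReal (2 * κ) = ENNReal.ofReal (1 - Real.exp (-ε)) * ENNReal.ofReal (1 / 4) := by
          rw [← ENNReal.ofReal_mul h1, hκε]; congr 1; ring
      _ ≤ ENNReal.ofReal (1 - Real.exp (-ε)) * P {S | ε ≤ (a S).2 - x.2} := by
          gcongr
          exact h.quarter_le_measure_height hlam hH hε hεlam
      _ ≤ ENNReal.ofReal (1 - Real.exp (-ε)) * P {S | ENNReal.ofReal (1 - Real.exp (-ε)) ≤ Y S} := by
          gcongr with S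
          intro hS
          exact ENNReal.ofReal_le_ofReal (by
            have := Real.exp_le_exp.2 (neg_le_neg hS); linarith)
      _ ≤ _ := mul_meas_ge_le_lintegral hYm _
  have hXl : ∫⁻ S, X S ∂P ≤ ENNReal.ofReal (1 - κ) := by
    have h1 : ∫⁻ S, X S ∂P + ENNReal.ofReal (2 * κ)
        ≤ ENNReal.ofReal (1 - κ) + ENNReal.ofReal (2 * κ) := by
      rw [← ENNReal.ofReal_add (by linarith) (by linarith)]
      refine (add_le_add_right hYl _).trans (hXY.trans (le_of_eq ?_))
      congr 1; ring
    exact (ENNReal.add_le_add_iff_right ENNReal.ofReal_ne_top).1 h1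
  calc ∫⁻ S, lyapunov η (nextHeight l x (a S)) ∂P
      ≤ ∫⁻ S, (1 + ENNReal.ofReal (η * Real.exp l) * X S) ∂P := by
        refine lintegral_mono fun S => (lyapunov_le hη.le _).trans (le_of_eq ?_)
        simp only [hX]
        rw [← ENNReal.ofReal_mul (by positivity), mul_assoc, ← Real.exp_add, nextHeight,
          norm_sub_rev x (a S)]
        congr 5
        have : max (‖a S - x‖ - l) 0 = max l ‖a S - x‖ - l := by
          rw [max_comm l, ← max_sub_sub_right, sub_self]
        rw [this]; ring
    _ = 1 + ENNReal.ofReal (η * Real.exp l) * ∫⁻ S, X S ∂P := by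
        rw [lintegral_add_left measurable_const, lintegral_const, measure_univ, mul_one,
          lintegral_const_mul _ hXm]
    _ ≤ 1 + ENNReal.ofReal (η * Real.exp l) * ENNReal.ofReal (1 - κ) := by gcongr
    _ = _ := by
        have : 0 ≤ η * Real.exp l * (1 - κ) := mul_nonneg (by positivity) (by linarith)
        rw [← ENNReal.ofReal_mul (by positivity), ← ENNReal.ofReal_one,
          ← ENNReal.ofReal_add zero_le_one this]

/-- A vertical step beyond height `L` empties the history set and kills the function. Otherwise the
constant part contributes at most `1 - p`, and the exponential part is controlled by the overshoot
above `L`. -/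
theorem lintegral_lyapunov_le_of_low (h : IsPoissonLaw lam P) (hlam : 0 < lam)
    (hH : IsObstacle x H l) {L κ η p : ℝ} (hL : 0 < L) (hlL : l ≤ L) (hκ0 : 0 < κ) (hη : 0 < η)
    (hp1 : p ≤ 1) (hp0 : 0 ≤ p)
    (hp : p ≤ lam * (2 * L) * Real.exp (-(lam * (2 * (L + 1) ^ 2))))
    (hL1 : 1 < 2 * lam * L) (hLκ : 1 / (2 * lam * L - 1) ≤ κ) :
    ∫⁻ S, lyapunov η (nextHeight l x (ancestor x (S.carrier ∩ (upperHalfPlane x.2 \ H)))) ∂P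
      ≤ ENNReal.ofReal (1 - p + η * (Real.exp L * (1 + κ))) := by
  have := h.isProbabilityMeasure
  have hanc := measurable_ancestor_free hH
  -- Regarding the obstacle as one of height `L` makes the estimates uniform in `l ≤ L`.
  have hHL := hH.mono hlL
  have hvert := h.le_measure_vertical_step hlam hHL hL
  have hover := h.lintegral_exp_overshoot_le hlam hHL hL1
  set a : Config → ℝ × ℝ := fun S => ancestor x (S.carrier ∩ (upperHalfPlane x.2 \ H)) with ha
  have hD : ∀ S, 0 ≤ (a S).2 - x.2 := fun S => sub_nonneg.2 (le_ancestor_snd _ _)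
  set G : Set Config := {S | max L ‖a S - x‖ ≤ (a S).2 - x.2} with hG
  have hGm : MeasurableSet G := measurableSet_le (by fun_prop) (by fun_prop)
  have hGc : P Gᶜ ≤ ENNReal.ofReal (1 - p) := by
    have h1 : P G + P Gᶜ = 1 := by rw [measure_add_measure_compl hGm, measure_univ]
    have h2 : ENNReal.ofReal p ≤ P G := (ENNReal.ofReal_le_ofReal hp).trans hvert
    have h3 : ENNReal.ofReal p + P Gᶜ ≤ ENNReal.ofReal p + ENNReal.ofReal (1 - p) := by
      rw [← ENNReal.ofReal_add hp0 (by linarith), add_sub_cancel, ENNReal.ofReal_one, ← h1]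
      exact add_le_add_left h2 _
    exact (ENNReal.add_le_add_iff_left ENNReal.ofReal_ne_top).1 h3
  set X : Config → ℝ≥0∞ := fun S => ENNReal.ofReal (Real.exp (max (‖a S - x‖ - L) 0)) with hX
  have hXm : Measurable X := by fun_prop
  have hpt : ∀ S, lyapunov η (nextHeight l x (a S)) ≤
      Gᶜ.indicator 1 S + ENNReal.ofReal (η * Real.exp L) * X S := by
    intro S
    by_cases hS : S ∈ G
    · have : nextHeight l x (a S) ≤ 0 := by
        have hS' : max L ‖a S - x‖ ≤ (a S).2 - x.2 := hS
        rw [nextHeight, norm_sub_rev]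
        have := max_le_max_right ‖a S - x‖ hlL
        linarith
      rw [lyapunov, if_pos this]
      exact zero_le
    · rw [Set.indicator_of_mem (show S ∈ Gᶜ from hS), Pi.one_apply]
      refine (lyapunov_le hη.le _).trans (add_le_add_right ?_ _)
      simp only [hX]
      rw [← ENNReal.ofReal_mul (by positivity), mul_assoc, ← Real.exp_add, nextHeight,
          norm_sub_rev x (a S)]
      have h1 : max (‖a S - x‖ - L) 0 = max L ‖a S - x‖ - L := by
        rw [max_comm L, ← max_sub_sub_right, sub_self]
      have h2 := max_le_max_right ‖a S - x‖ hlL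
      have h3 := hD S
      gcongr
      linarith
  calc ∫⁻ S, lyapunov η (nextHeight l x (a S)) ∂P
      ≤ ∫⁻ S, (Gᶜ.indicator 1 S + ENNReal.ofReal (η * Real.exp L) * X S) ∂P :=
        lintegral_mono hpt
    _ = P Gᶜ + ENNReal.ofReal (η * Real.exp L) * ∫⁻ S, X S ∂P := by
        rw [lintegral_add_left (measurable_one.indicator hGm.compl),
          lintegral_indicator_one hGm.compl, lintegral_const_mul _ hXm]
    _ ≤ ENNReal.ofReal (1 - p) + ENNReal.ofReal (η * Real.exp L) * ENNReal.ofReal (1 + κ) := by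
        gcongr
        exact hover.trans (ENNReal.ofReal_le_ofReal (by linarith))
    _ = _ := by
        rw [← ENNReal.ofReal_mul (by positivity), ← ENNReal.ofReal_add (by linarith) (by positivity),
          mul_assoc]

end IsPoissonLaw

/-- Geometric decay of the Lyapunov function in one step. -/
theorem exists_lyapunov_drift {lam : ℝ} (hlam : 0 < lam) : ∃ η ρ : ℝ, 0 < η ∧ 0 < ρ ∧ ρ < 1 ∧
    ∀ (P : Measure Config), IsPoissonLaw lam P → ∀ (x : ℝ × ℝ) (H : Set (ℝ × ℝ)) (l : ℝ),
      IsObstacle x H l →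
      ∫⁻ S, lyapunov η (nextHeight l x (ancestor x (S.carrier ∩ (upperHalfPlane x.2 \ H)))) ∂P
        ≤ ENNReal.ofReal (ρ * (1 + η * Real.exp l)) := by
  obtain ⟨ε, κ, L, hε, hκ0, hκ1, hL, hεlam, hκε, hlarge⟩ := exists_step_constants hlam
  set p := min 1 (lam * (2 * L) * Real.exp (-(lam * (2 * (L + 1) ^ 2)))) with hp
  have hp0 : 0 < p := lt_min one_pos (by positivity)
  have hp1 : p ≤ 1 := min_le_left _ _
  set K := Real.exp L * (1 + κ) with hK
  have hK0 : 0 < K := by positivity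
  -- With this weight the exponential part costs at most half of the gain `p` at low heights.
  set η := p / (2 * K) with hη
  have hη0 : 0 < η := by positivity
  have hηK : η * K = p / 2 := by rw [hη]; field_simp
  -- The first entry serves low heights. The second serves high ones, where `η κ exp l ≥ (η κ / (1 +
  -- η)) * (1 + η exp l)` because `exp l ≥ 1`.
  set ρ := max (1 - p / 2) (1 - η * κ / (1 + η)) with hρ
  have h1 : 1 - p / 2 ≤ ρ := le_max_left _ _
  have h2 : 1 - η * κ / (1 + η) ≤ ρ := le_max_right _ _
  have hρ0 : 0 < ρ := by linarith
  have hq : 0 < η * κ / (1 + η) := by positivity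
  have hρ1 : ρ < 1 := max_lt (by linarith) (by linarith)
  refine ⟨η, ρ, hη0, hρ0, hρ1, fun P h x H l hH => ?_⟩
  have hexp : 1 ≤ Real.exp l := Real.one_le_exp hH.nonneg
  rcases le_total L l with hl | hl
  · obtain ⟨h3, h4⟩ := hlarge l hl
    refine (h.lintegral_lyapunov_le_of_high hlam hH hε hεlam hκε hκ0 hκ1 hη0 h3 h4).trans
      (ENNReal.ofReal_le_ofReal ?_)
    have h5 : (η * κ / (1 + η)) * (1 + η) = η * κ := by field_simp
    have h6 : (1 - η * κ / (1 + η)) * (1 + η * Real.exp l) ≤ ρ * (1 + η * Real.exp l) :=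
      mul_le_mul_of_nonneg_right h2 (by positivity)
    refine le_trans ?_ h6
    have h7 : η * κ / (1 + η) ≤ κ := by
      rw [div_le_iff₀ (by positivity)]; nlinarith
    have h8 : 0 ≤ (κ - η * κ / (1 + η)) * (η * (Real.exp l - 1)) :=
      mul_nonneg (by linarith) (mul_nonneg hη0.le (by linarith))
    nlinarith
  · obtain ⟨h3, h4⟩ := hlarge L le_rfl
    refine (h.lintegral_lyapunov_le_of_low hlam hH hL hl hκ0 hη0 hp1 hp0.le (min_le_right _ _)
      h3 h4).trans (ENNReal.ofReal_le_ofReal ?_)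
    rw [← hK, hηK]
    nlinarith [mul_pos hη0 (Real.exp_pos l)]

/-! ### History sets along a path, and the step recursion of both explorations. -/

/-- The height of the history set above the current position of a path. -/
def historyHeight (g : ℕ → ℝ × ℝ) : ℕ → ℝ
  | 0 => 0
  | n + 1 => nextHeight (historyHeight g n) (g n) (g (n + 1))

/-- The part of the plane above the current position that is outside of the history set. -/
def freeRegion (g : ℕ → ℝ × ℝ) (n : ℕ) : Set (ℝ × ℝ) := upperHalfPlane (g n).2 \ history g n

/-- The path `g`, stopped at step `n`. -/
def stopAt (n : ℕ) (g : ℕ → ℝ × ℝ) : ℕ → ℝ × ℝ := fun k => g (min k n)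

/-- The path that follows `g` up to step `n` and then stays at `y`. -/
def extendBy (n : ℕ) (g : ℕ → ℝ × ℝ) (y : ℝ × ℝ) : ℕ → ℝ × ℝ := fun k => if k ≤ n then g k else y

theorem stopAt_apply_of_le {n k : ℕ} (g : ℕ → ℝ × ℝ) (h : k ≤ n) : stopAt n g k = g k := by
  simp [stopAt, h]

theorem extendBy_stopAt (n : ℕ) (g : ℕ → ℝ × ℝ) :
    extendBy n (stopAt n g) (g (n + 1)) = stopAt (n + 1) g := by
  funext k
  unfold extendBy stopAt
  split_ifs with h
  · rw [min_eq_left h, min_eq_left (h.trans n.le_succ)]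
  · rw [min_eq_right (by omega)]

theorem extendBy_of_le {n k : ℕ} (g : ℕ → ℝ × ℝ) (y : ℝ × ℝ) (h : k ≤ n) :
    extendBy n g y k = g k := if_pos h

theorem extendBy_succ (n : ℕ) (g : ℕ → ℝ × ℝ) (y : ℝ × ℝ) : extendBy n g y (n + 1) = y :=
  if_neg (by omega)

theorem history_congr {g g' : ℕ → ℝ × ℝ} {n : ℕ} (h : ∀ k ≤ n, g k = g' k) :
    history g n = history g' n := by
  induction n with
  | zero => rfl
  | succ n ih =>
    simp only [history, ih fun k hk => h k (hk.trans n.le_succ), h n n.le_succ, h (n + 1) le_rfl]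

theorem freeRegion_congr {g g' : ℕ → ℝ × ℝ} {n : ℕ} (h : ∀ k ≤ n, g k = g' k) :
    freeRegion g n = freeRegion g' n := by
  rw [freeRegion, freeRegion, history_congr h, h n le_rfl]

theorem historyHeight_congr {g g' : ℕ → ℝ × ℝ} {n : ℕ} (h : ∀ k ≤ n, g k = g' k) :
    historyHeight g n = historyHeight g' n := by
  induction n with
  | zero => rfl
  | succ n ih =>
    simp only [historyHeight, ih fun k hk => h k (hk.trans n.le_succ), h n n.le_succ,
      h (n + 1) le_rfl]

theorem nextHeight_nonneg (l : ℝ) (x y : ℝ × ℝ) : 0 ≤ nextHeight l x y := by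
  have := snd_sub_le_norm x y
  rw [norm_sub_rev] at this
  unfold nextHeight
  linarith [le_max_right l ‖x - y‖]

theorem historyHeight_nonneg (g : ℕ → ℝ × ℝ) (n : ℕ) : 0 ≤ historyHeight g n := by
  cases n with
  | zero => exact le_rfl
  | succ n => exact nextHeight_nonneg _ _ _

theorem history_subset_upperHalfPlane (g : ℕ → ℝ × ℝ) (n : ℕ) :
    history g n ⊆ upperHalfPlane (g n).2 := by
  cases n with
  | zero => exact Set.empty_subset _
  | succ n => exact Set.inter_subset_right

theorem mem_upperBall {x y : ℝ × ℝ} {r : ℝ} :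
    y ∈ upperBall x r ↔ ‖y - x‖ < r ∧ x.2 < y.2 := by
  simp [upperBall, upperHalfPlane, dist_eq_norm]

theorem exists_mem_upperBall {x : ℝ × ℝ} {r t : ℝ} (ht : x.2 ≤ t) :
    (∃ z ∈ upperBall x r, t < z.2) ↔ t < x.2 + r := by
  constructor
  · rintro ⟨z, hz, htz⟩
    have := snd_sub_le_norm x z
    linarith [(mem_upperBall.1 hz).1]
  · intro h
    have hs : x.2 < (t + (x.2 + r)) / 2 := by linarith
    refine ⟨(x.1, (t + (x.2 + r)) / 2), mem_upperBall.2 ⟨?_, hs⟩, by simp only; linarith⟩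
    rw [Prod.norm_def, Prod.fst_sub, Prod.snd_sub]
    simp only [sub_self, norm_zero, Real.norm_eq_abs]
    rw [abs_of_pos (by linarith), max_lt_iff]
    constructor <;> linarith

section Mono
variable {g : ℕ → ℝ × ℝ} (hg : ∀ n, (g n).2 ≤ (g (n + 1)).2)
include hg

/-- The pieces of the history set are open at the top, so the height is a supremum that is not
attained; it is described by the levels exceeded by some point. -/
theorem exists_mem_history_iff (n : ℕ) {t : ℝ} (ht : (g n).2 ≤ t) :
    (∃ z ∈ history g n, t < z.2) ↔ t < (g n).2 + historyHeight g n := by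
  induction n generalizing t with
  | zero => simpa [history, historyHeight] using ht
  | succ n ih =>
    have h1 : (∃ z ∈ history g (n + 1), t < z.2) ↔ (∃ z ∈ history g n, t < z.2) ∨
        (∃ z ∈ upperBall (g n) ‖g n - g (n + 1)‖, t < z.2) := by
      simp only [history, nextHistory]
      constructor
      · rintro ⟨z, ⟨hz | hz, -⟩, htz⟩
        · exact Or.inl ⟨z, hz, htz⟩
        · exact Or.inr ⟨z, hz, htz⟩
      · rintro (⟨z, hz, htz⟩ | ⟨z, hz, htz⟩)
        · exact ⟨z, ⟨Or.inl hz, ht.trans_lt htz⟩, htz⟩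
        · exact ⟨z, ⟨Or.inr hz, ht.trans_lt htz⟩, htz⟩
    rw [h1, ih ((hg n).trans ht), exists_mem_upperBall ((hg n).trans ht), historyHeight, nextHeight,
      ← lt_max_iff, max_add_add_left]
    constructor <;> intro h <;> linarith

theorem history_eq_empty_iff (n : ℕ) : history g n = ∅ ↔ historyHeight g n ≤ 0 := by
  have h := exists_mem_history_iff hg n (le_refl (g n).2)
  constructor
  · intro he
    by_contra! hlt
    obtain ⟨z, hz, -⟩ := h.2 (by linarith)
    rw [he] at hz
    exact hz
  · intro hle
    by_contra hne
    obtain ⟨z, hz⟩ := Set.nonempty_iff_ne_empty.2 hne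
    have := h.1 ⟨z, hz, history_subset_upperHalfPlane g n hz⟩
    linarith

/-- Lowering a point while staying above the centre does not increase its distance to the centre, so
upper balls have this property, and it passes to unions and to higher half-planes. -/
theorem downward_history (n : ℕ) : ∀ y ∈ history g n, ∀ t, (g n).2 < t → t ≤ y.2 →
    (y.1, t) ∈ history g n := by
  induction n with
  | zero => intro y hy; exact hy.elim
  | succ n ih =>
    rintro y ⟨hy | hy, hy2⟩ t ht hty
    · exact ⟨Or.inl (ih y hy t ((hg n).trans_lt ht) hty), ht⟩
    · refine ⟨Or.inr ?_, ht⟩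
      rw [mem_upperBall] at hy ⊢
      have h1 : (g n).2 < t := (hg n).trans_lt ht
      refine ⟨lt_of_le_of_lt ?_ hy.1, h1⟩
      rw [Prod.norm_def, Prod.norm_def]
      simp only [Prod.fst_sub, Prod.snd_sub, Real.norm_eq_abs]
      rw [abs_of_pos (sub_pos.2 h1), abs_of_pos (sub_pos.2 hy.2)]
      exact max_le_max_left _ (by linarith)

theorem freeRegion_succ_subset (n : ℕ) : freeRegion g (n + 1) ⊆ freeRegion g n :=
  fun _ hy => ⟨(hg n).trans_lt hy.1, fun h => hy.2 ⟨Or.inl h, hy.1⟩⟩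

end Mono

theorem measurableSet_mem_history (n : ℕ) :
    MeasurableSet {p : (ℕ → ℝ × ℝ) × (ℝ × ℝ) | p.2 ∈ history p.1 n} := by
  induction n with
  | zero => exact MeasurableSet.empty
  | succ n ih =>
    have h1 : MeasurableSet {p : (ℕ → ℝ × ℝ) × (ℝ × ℝ) |
        p.2 ∈ upperBall (p.1 n) ‖p.1 n - p.1 (n + 1)‖} := by
      have h3 : MeasurableSet {p : (ℕ → ℝ × ℝ) × (ℝ × ℝ) |
          ‖p.2 - p.1 n‖ < ‖p.1 n - p.1 (n + 1)‖} := measurableSet_lt (by fun_prop) (by fun_prop)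
      have h4 : MeasurableSet {p : (ℕ → ℝ × ℝ) × (ℝ × ℝ) | (p.1 n).2 < p.2.2} :=
        measurableSet_lt (by fun_prop) (by fun_prop)
      simp only [mem_upperBall]
      exact h3.inter h4
    have h2 : MeasurableSet {p : (ℕ → ℝ × ℝ) × (ℝ × ℝ) | (p.1 (n + 1)).2 < p.2.2} :=
      measurableSet_lt (by fun_prop) (by fun_prop)
    exact (ih.union h1).inter h2

theorem measurableSet_mem_freeRegion (n : ℕ) :
    MeasurableSet {p : (ℕ → ℝ × ℝ) × (ℝ × ℝ) | p.2 ∈ freeRegion p.1 n} := by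
  have h2 : MeasurableSet {p : (ℕ → ℝ × ℝ) × (ℝ × ℝ) | (p.1 n).2 < p.2.2} :=
      measurableSet_lt (by fun_prop) (by fun_prop)
  exact h2.inter (measurableSet_mem_history n).compl

theorem measurableSet_history (g : ℕ → ℝ × ℝ) (n : ℕ) : MeasurableSet (history g n) :=
  measurable_prodMk_left (x := g) (measurableSet_mem_history n)

theorem measurable_historyHeight (n : ℕ) :
    Measurable fun g : ℕ → ℝ × ℝ => historyHeight g n := by
  induction n with
  | zero => exact measurable_const
  | succ n ih =>
    simp only [historyHeight, nextHeight]
    fun_prop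

theorem isObstacle_history {g : ℕ → ℝ × ℝ} (hg : ∀ n, (g n).2 ≤ (g (n + 1)).2) (n : ℕ) :
    IsObstacle (g n) (history g n) (historyHeight g n) where
  measurableSet := measurableSet_history g n
  nonneg := historyHeight_nonneg g n
  le_height y hy := by
    by_contra! hlt
    have h0 := historyHeight_nonneg g n
    have := (exists_mem_history_iff hg n (t := (g n).2 + historyHeight g n) (by linarith)).1
      ⟨y, hy, hlt⟩
    exact lt_irrefl _ this
  downward := downward_history hg n

theorem measurable_extendBy (n : ℕ) :
    Measurable fun p : (ℕ → ℝ × ℝ) × (ℝ × ℝ) => extendBy n p.1 p.2 := by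
  refine measurable_pi_lambda _ fun k => ?_
  unfold extendBy
  split_ifs <;> fun_prop

theorem path_snd_mono (S : Set (ℝ × ℝ)) (x : ℝ × ℝ) (n : ℕ) :
    (path S x n).2 ≤ (path S x (n + 1)).2 := le_ancestor_snd _ _

/-- No point of `S` lies closer above a position than its ancestor. If there is no unique ancestor,
the path stays in place and the added ball is empty, so the claim holds for every `S`. -/
theorem disjoint_history_path (S : Set (ℝ × ℝ)) (x : ℝ × ℝ) (n : ℕ) :
    Disjoint S (history (path S x) n) := by
  induction n with
  | zero => exact Set.disjoint_empty _
  | succ n ih =>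
    refine Disjoint.mono_right Set.inter_subset_left (Set.disjoint_union_right.2 ⟨ih, ?_⟩)
    refine Set.disjoint_left.2 fun z hz hzB => ?_
    rw [mem_upperBall] at hzB
    change ‖z - path S x n‖ < ‖path S x n - ancestor (path S x n) S‖ ∧ _ at hzB
    by_cases h : HasAncestor (path S x n) S
    · have := h.isNearestAbove.2 z hz hzB.2
      rw [norm_sub_rev (ancestor _ _)] at this
      exact absurd hzB.1 (not_lt.2 this)
    · rw [ancestor_of_not h, sub_self, norm_zero] at hzB
      exact absurd hzB.1 (not_lt.2 (norm_nonneg _))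

/-- This puts the path of a single process in the same form as `resampledPath_succ`, with a search
in the free region only. -/
theorem path_succ (S : Set (ℝ × ℝ)) (x : ℝ × ℝ) (n : ℕ) :
    path S x (n + 1) = ancestor (path S x n) (S ∩ freeRegion (path S x) n) := by
  refine ancestor_congr fun y hy => ⟨fun h => ⟨h, hy, fun h' => ?_⟩, fun h => h.1⟩
  exact Set.disjoint_left.1 (disjoint_history_path S x n) h h'

theorem resampledPath_succ (S : ℕ → Set (ℝ × ℝ)) (x : ℝ × ℝ) (n : ℕ) :
    resampledPath S x (n + 1) = ancestor (resampledPath S x n)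
      (S (n + 1) ∩ freeRegion (resampledPath S x) n) := by
  change ancestor (resampledPath S x n) (S (n + 1) \ (resampledState S x n).2) = _
  rw [← history_resampledPath]
  exact ancestor_congr fun y hy => ⟨fun h => ⟨h.1, hy, h.2⟩, fun h => ⟨h.1, h.2.2⟩⟩

/-! ### Freshness of the unexplored region. -/

theorem Config.measurableSet_mem_void {α : Type*} [MeasurableSpace α] {D : α → Set (ℝ × ℝ)}
    (hD : MeasurableSet {p : α × (ℝ × ℝ) | p.2 ∈ D p.1}) :
    MeasurableSet {p : α × Config | p.2 ∈ Config.void (D p.1)} := by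
  have hT : MeasurableSet {q : (α × Config) × (ℝ × ℝ) | q.2 ∈ D q.1.1} :=
    (measurable_fst.fst.prodMk measurable_snd) hD
  convert Config.measurable_count_section hT (measurableSet_singleton (0 : ℝ≥0∞)) using 1
  ext p
  exact (Config.count_eq_zero_iff (measurable_prodMk_left (x := p) hT)).symm

theorem Config.restrict_mem_void {S : Config} {C D : Set (ℝ × ℝ)} :
    S.restrict C ∈ Config.void D ↔ S ∈ Config.void (C ∩ D) := by
  simp only [Config.mem_void, Config.restrict, Set.disjoint_iff_inter_eq_empty, Set.inter_assoc]

namespace IsPoissonLaw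
variable {lam : ℝ} {P : Measure Config} {x : ℝ × ℝ} {H : Set (ℝ × ℝ)} {l : ℝ}

theorem void_inter_of_null (h : IsPoissonLaw lam P) {A D : Set (ℝ × ℝ)} (hA : MeasurableSet A)
    (hD : MeasurableSet D) (h0 : volume (D ∩ A) = 0) :
    P (Config.void A ∩ Config.void D) = P (Config.void A) * P (Config.void D) := by
  rw [← Config.void_union, ← Set.union_sdiff_self, Config.void_union,
    h.void_inter A (D \ A) hA (hD.diff hA) Set.disjoint_sdiff_right]
  congr 1
  refine h.void_congr (hD.diff hA) hD ?_ ?_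
  · rwa [sdiff_sdiff_right_self]
  · rw [Set.sdiff_eq_empty.2 Set.sdiff_subset, measure_empty]

/-- Given the ancestor `y`, the points in a region `D y` outside of the explored ball are those of
a fresh Poisson process. -/
theorem lintegral_ancestor_mul_void (h : IsPoissonLaw lam P) (hlam : 0 < lam)
    (hH : IsObstacle x H l) {f : ℝ × ℝ → ℝ≥0∞} (hf : Measurable f) {D : ℝ × ℝ → Set (ℝ × ℝ)}
    (hD : MeasurableSet {p : (ℝ × ℝ) × (ℝ × ℝ) | p.2 ∈ D p.1})
    (hyD : ∀ y, y ∉ D y)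
    (hnull : ∀ y, volume (D y ∩ closedUpperBall x ‖y - x‖) = 0) :
    ∫⁻ S, f (ancestor x (S.carrier ∩ (upperHalfPlane x.2 \ H))) *
        (Config.void (D (ancestor x (S.carrier ∩ (upperHalfPlane x.2 \ H))))).indicator 1 S ∂P
      = ∫⁻ S, f (ancestor x (S.carrier ∩ (upperHalfPlane x.2 \ H))) *
        P (Config.void (D (ancestor x (S.carrier ∩ (upperHalfPlane x.2 \ H))))) ∂P := by
  classical
  have := h.isProbabilityMeasure
  set C := upperHalfPlane x.2 \ H with hCdef
  have hC : MeasurableSet C := (measurableSet_upperHalfPlane _).diff hH.measurableSet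
  have hDm : ∀ y, MeasurableSet (D y) := fun y => measurable_prodMk_left (x := y) hD
  have hV : MeasurableSet {p : (ℝ × ℝ) × Config | p.2 ∈ Config.void (D p.1)} :=
    Config.measurableSet_mem_void hD
  have hV' : MeasurableSet {p : Config × (ℝ × ℝ) | p.1 ∈ Config.void (D p.2)} :=
    measurable_swap hV
  have hm1 : Measurable fun p : Config × (ℝ × ℝ) =>
      f p.2 * {p : Config × (ℝ × ℝ) | p.1 ∈ Config.void (D p.2)}.indicator 1 p :=
    (hf.comp measurable_snd).mul (measurable_one.indicator hV')
  have hm2 : Measurable fun p : Config × (ℝ × ℝ) => f p.2 * P (Config.void (D p.2)) :=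
    (hf.comp measurable_snd).mul ((measurable_measure_prodMk_left hV).comp measurable_snd)
  have h1 := h.lintegral_ancestor hC Set.sdiff_subset hm1
  have h2 := h.lintegral_ancestor hC Set.sdiff_subset hm2
  have hae := h.ae_hasAncestor hlam hH
  refine Eq.trans (lintegral_congr_ae ?_) (h1.trans (Eq.trans ?_
    (h2.symm.trans (lintegral_congr_ae ?_))))
  · filter_upwards [hae] with S hS
    rw [if_pos hS]
    rfl
  · congr 1
    refine lintegral_congr fun y => ?_
    have hA : MeasurableSet ((C ∩ closedUpperBall x ‖y - x‖) \ {y}) :=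
      (hC.inter (measurableSet_closedUpperBall _ _)).diff (measurableSet_singleton _)
    have e1 : ∀ S : Config, f (Config.insert y S, y).2 *
        {p : Config × (ℝ × ℝ) | p.1 ∈ Config.void (D p.2)}.indicator 1 (Config.insert y S, y)
        = f y * (Config.void (D y)).indicator 1 S := by
      intro S
      have : (Config.insert y S, y) ∈ {p : Config × (ℝ × ℝ) | p.1 ∈ Config.void (D p.2)} ↔
          S ∈ Config.void (D y) := by
        change Config.insert y S ∈ Config.void (D y) ↔ _
        rw [Config.insert_mem_void]
        simp [hyD y]
      by_cases hS : S ∈ Config.void (D y)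
      · rw [Set.indicator_of_mem (this.2 hS), Set.indicator_of_mem hS]; rfl
      · rw [Set.indicator_of_notMem (fun h => hS (this.1 h)), Set.indicator_of_notMem hS]
    simp_rw [e1]
    change _ = ∫⁻ _ in _, f y * P (Config.void (D y)) ∂P
    have hvD := Config.measurableSet_void (hDm y)
    -- After Mecke's formula the ancestor is a fixed `y`. The event selecting `y` and the event
    -- `void (D y)` concern regions with null intersection, so they are independent.
    rw [lintegral_const_mul _ (measurable_one.indicator hvD),
      lintegral_indicator_one hvD, setLIntegral_const, Measure.restrict_apply hvD, Set.inter_comm,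
      h.void_inter_of_null hA (hDm y)]
    · ring
    · exact measure_mono_null (t := D y ∩ closedUpperBall x ‖y - x‖)
        (fun z hz => ⟨hz.1, hz.2.1.2⟩) (hnull y)
  · filter_upwards [hae] with S hS
    rw [if_pos hS]

end IsPoissonLaw

/-- Outside of the explored region, the points `M` that are used for step `n + 1` of the path `g`
are distributed as those of an independent Poisson process. -/
def IsFresh {Ω : Type*} [MeasurableSpace Ω] (μ : Measure Ω) (P : Measure Config)
    (g : Ω → ℕ → ℝ × ℝ) (M : Ω → Config) (n : ℕ) : Prop :=
  μ.map (fun ω => (g ω, (M ω).restrict (freeRegion (g ω) n)))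
    = (μ.prod P).map (fun p => (g p.1, p.2.restrict (freeRegion (g p.1) n)))

theorem measurable_restrict_freeRegion (n : ℕ) :
    Measurable fun p : (ℕ → ℝ × ℝ) × Config => (p.1, p.2.restrict (freeRegion p.1 n)) :=
  measurable_fst.prodMk (Config.measurable_restrict (C := fun g => freeRegion g n)
    (measurableSet_mem_freeRegion n))

section Fresh
variable {Ω : Type*} [MeasurableSpace Ω] {μ : Measure Ω} [IsProbabilityMeasure μ]
  {lam : ℝ} {P : Measure Config} {M : Ω → Config}

theorem IsFresh.of_indepFun {g : Ω → ℕ → ℝ × ℝ} (hg : Measurable g) (hM : Measurable M)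
    (h : IndepFun g M μ) (n : ℕ) : IsFresh μ (μ.map M) g M n := by
  have hP : IsProbabilityMeasure (μ.map M) := Measure.isProbabilityMeasure_map hM.aemeasurable
  have h1 := (indepFun_iff_map_prod_eq_prod_map_map hg.aemeasurable hM.aemeasurable).1 h
  have hr := measurable_restrict_freeRegion n
  have h2 := congrArg (Measure.map
    fun p : (ℕ → ℝ × ℝ) × Config => (p.1, p.2.restrict (freeRegion p.1 n))) h1
  rw [Measure.map_map hr (hg.prodMk hM)] at h2
  have h3 : (μ.map g).prod (μ.map M) = (μ.prod (μ.map M)).map (Prod.map g id) := by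
    rw [← Measure.map_prod_map _ _ hg measurable_id, Measure.map_id]
  rw [h3, Measure.map_map hr (hg.prodMap measurable_id)] at h2
  exact h2

omit [IsProbabilityMeasure μ] in
theorem IsFresh.lintegral_eq [SFinite P] {g : Ω → ℕ → ℝ × ℝ} (hg : Measurable g)
    (hM : Measurable M)
    {n : ℕ} (h : IsFresh μ P g M n) {F : (ℕ → ℝ × ℝ) × Config → ℝ≥0∞} (hF : Measurable F) :
    ∫⁻ ω, F (g ω, (M ω).restrict (freeRegion (g ω) n)) ∂μ
      = ∫⁻ ω, ∫⁻ S, F (g ω, S.restrict (freeRegion (g ω) n)) ∂P ∂μ := by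
  have hr := measurable_restrict_freeRegion n
  have h1 : Measurable fun ω => (g ω, (M ω).restrict (freeRegion (g ω) n)) :=
    hr.comp (hg.prodMk hM)
  have h2 : Measurable fun p : Ω × Config => (g p.1, p.2.restrict (freeRegion (g p.1) n)) :=
    hr.comp (hg.prodMap measurable_id)
  rw [← lintegral_map hF h1, h, lintegral_map hF h2]
  exact lintegral_prod _ (hF.comp h2).aemeasurable

/-- The history set absorbs the open ball, while the ancestor was searched in the closed one. What
remains lies on a sphere, which is null. -/
theorem volume_freeRegion_extendBy_inter (n : ℕ) (g : ℕ → ℝ × ℝ) (y : ℝ × ℝ) :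
    volume (freeRegion (extendBy n g y) (n + 1) ∩ closedUpperBall (g n) ‖y - g n‖) = 0 := by
  refine measure_mono_null (t := Metric.sphere (g n) ‖y - g n‖) (fun z hz => ?_)
    (Measure.addHaar_sphere _ _ _)
  obtain ⟨⟨hz1, hz2⟩, hz3⟩ := hz
  rw [mem_closedUpperBall] at hz3
  rw [mem_sphere_iff_norm]
  refine le_antisymm hz3.1 ?_
  by_contra! hlt
  refine hz2 ⟨Or.inr (mem_upperBall.2 ?_), hz1⟩
  rw [extendBy_of_le g y le_rfl, extendBy_succ, norm_sub_rev (g n) y]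
  exact ⟨hlt, hz3.2⟩

theorem measurable_extendBy_ancestor (n : ℕ) : Measurable fun p : (ℕ → ℝ × ℝ) × Config =>
    extendBy n p.1 (ancestor (p.1 n) p.2.carrier) :=
  (measurable_extendBy n).comp (measurable_fst.prodMk
    (measurable_ancestor (x := fun g : ℕ → ℝ × ℝ => g n) (measurable_pi_apply n)))

/-- In the exploration of one Poisson process the unexplored region stays fresh. -/
theorem IsFresh.succ (hP : IsPoissonLaw lam P) (hlam : 0 < lam) {g : Ω → ℕ → ℝ × ℝ}
    (hg : Measurable g) (hM : Measurable M) (hmono : ∀ ω n, (g ω n).2 ≤ (g ω (n + 1)).2) {n : ℕ}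
    (hstep : ∀ ω, g ω (n + 1) = ancestor (g ω n) ((M ω).carrier ∩ freeRegion (g ω) n))
    (h : IsFresh μ P (fun ω => stopAt n (g ω)) M n) :
    IsFresh μ P (fun ω => stopAt (n + 1) (g ω)) M (n + 1) := by
  have := hP.isProbabilityMeasure
  have hmst : ∀ n, Measurable fun ω => stopAt n (g ω) := fun n =>
    measurable_pi_lambda _ fun k => (measurable_pi_apply _).comp hg
  have hfr : ∀ ω, freeRegion (stopAt n (g ω)) n = freeRegion (g ω) n := fun ω =>
    freeRegion_congr fun k hk => stopAt_apply_of_le _ hk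
  have hfr1 : ∀ ω, freeRegion (stopAt (n + 1) (g ω)) (n + 1) = freeRegion (g ω) (n + 1) := fun ω =>
    freeRegion_congr fun k hk => stopAt_apply_of_le _ hk
  have hext : ∀ ω, extendBy n (stopAt n (g ω)) (ancestor (stopAt n (g ω) n)
      ((M ω).restrict (freeRegion (stopAt n (g ω)) n)).carrier) = stopAt (n + 1) (g ω) := by
    intro ω
    rw [hfr, stopAt_apply_of_le _ le_rfl, ← extendBy_stopAt, hstep]
    rfl
  have hr := measurable_restrict_freeRegion
  have hm1 : Measurable fun ω => (stopAt (n + 1) (g ω),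
      (M ω).restrict (freeRegion (stopAt (n + 1) (g ω)) (n + 1))) :=
    (hr (n + 1)).comp ((hmst (n + 1)).prodMk hM)
  have hm2 : Measurable fun p : Ω × Config => (stopAt (n + 1) (g p.1),
      p.2.restrict (freeRegion (stopAt (n + 1) (g p.1)) (n + 1))) :=
    (hr (n + 1)).comp ((hmst (n + 1)).prodMap measurable_id)
  have hp1 := Measure.isProbabilityMeasure_map (μ := μ) hm1.aemeasurable
  have hp2 := Measure.isProbabilityMeasure_map (μ := μ.prod P) hm2.aemeasurable
  -- The two laws are compared on products of an event of the path with a void event.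
  refine Measure.ext_of_generateFrom_of_iUnion
    (Set.image2 (· ×ˢ ·) {s | MeasurableSet s} Config.voidEvents)
    (fun _ => Set.univ) ?_ ?_ (Set.iUnion_const _) ?_ (fun _ => measure_ne_top _ _) ?_
  · exact (generateFrom_eq_prod MeasurableSpace.generateFrom_measurableSet rfl
      isCountablySpanning_measurableSet Config.isCountablySpanning_voidEvents).symm
  · exact MeasurableSpace.isPiSystem_measurableSet.prod Config.isPiSystem_voidEvents
  · intro _
    have hu : MeasurableSet (Set.univ : Set (ℕ → ℝ × ℝ)) := .univ
    exact ⟨_, hu, _, ⟨∅, .empty, Config.void_empty.symm⟩, Set.univ_prod_univ⟩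
  rintro _ ⟨E, hE, _, ⟨B, hB, rfl⟩, rfl⟩
  have hE' : MeasurableSet E := hE
  have hEB : MeasurableSet (E ×ˢ Config.void B) := hE'.prod (Config.measurableSet_void hB)
  rw [Measure.map_apply hm1 hEB, Measure.map_apply hm2 hEB]
  have hQ : MeasurableSet {p : (ℕ → ℝ × ℝ) × (ℝ × ℝ) | p.2 ∈ freeRegion p.1 (n + 1) ∩ B} :=
    (measurableSet_mem_freeRegion (n + 1)).inter (measurable_snd hB)
  have hQv := Config.measurableSet_mem_void (D := fun g => freeRegion g (n + 1) ∩ B) hQ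
  have hex := measurable_extendBy_ancestor n
  have hexE : Measurable fun p : (ℕ → ℝ × ℝ) × Config =>
      E.indicator (1 : (ℕ → ℝ × ℝ) → ℝ≥0∞) (extendBy n p.1 (ancestor (p.1 n) p.2.carrier)) :=
    (measurable_one.indicator hE').comp hex
  -- `F1` tests the actual points beyond step `n + 1`, whereas `F2` replaces that test by its
  -- probability under an independent process. Both depend only on the path up to `n` and the points
  -- free at `n`, so the induction hypothesis applies to each.
  set F1 : (ℕ → ℝ × ℝ) × Config → ℝ≥0∞ := fun p =>
    E.indicator 1 (extendBy n p.1 (ancestor (p.1 n) p.2.carrier)) *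
      {q : (ℕ → ℝ × ℝ) × Config | q.2 ∈ Config.void (freeRegion q.1 (n + 1) ∩ B)}.indicator 1
        (extendBy n p.1 (ancestor (p.1 n) p.2.carrier), p.2) with hF1
  have hF1m : Measurable F1 :=
    hexE.mul ((measurable_one.indicator hQv).comp (hex.prodMk measurable_snd))
  set F2 : (ℕ → ℝ × ℝ) × Config → ℝ≥0∞ := fun p =>
    E.indicator 1 (extendBy n p.1 (ancestor (p.1 n) p.2.carrier)) *
      P (Config.void (freeRegion (extendBy n p.1 (ancestor (p.1 n) p.2.carrier)) (n + 1) ∩ B))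
    with hF2
  have hF2m : Measurable F2 := hexE.mul ((measurable_measure_prodMk_left hQv).comp hex)
  have key : ∀ ω, ∫⁻ S, F1 (stopAt n (g ω), S.restrict (freeRegion (stopAt n (g ω)) n)) ∂P
      = ∫⁻ S, F2 (stopAt n (g ω), S.restrict (freeRegion (stopAt n (g ω)) n)) ∂P := by
    intro ω
    set γ := stopAt n (g ω) with hγ
    have hγmono : ∀ k, (γ k).2 ≤ (γ (k + 1)).2 := by
      intro k
      simp only [hγ, stopAt]
      rcases le_or_gt n k with hk | hk
      · rw [min_eq_right hk, min_eq_right (hk.trans k.le_succ)]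
      · rw [min_eq_left hk.le, min_eq_left (by omega)]; exact hmono ω k
    have hD : MeasurableSet {p : (ℝ × ℝ) × (ℝ × ℝ) |
        p.2 ∈ freeRegion (extendBy n γ p.1) (n + 1) ∩ B} :=
      (((measurable_extendBy n).comp (measurable_const.prodMk measurable_fst)).prodMk
        measurable_snd) hQ
    have hf : Measurable fun y => E.indicator (1 : (ℕ → ℝ × ℝ) → ℝ≥0∞) (extendBy n γ y) :=
      (measurable_one.indicator hE').comp
        ((measurable_extendBy n).comp (measurable_const.prodMk measurable_id))
    have hobs := isObstacle_history hγmono n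
    have hmain := hP.lintegral_ancestor_mul_void hlam hobs hf
      (D := fun y => freeRegion (extendBy n γ y) (n + 1) ∩ B) hD
      (fun y hy => by
        have := hy.1.1
        rw [extendBy_succ] at this
        exact absurd this (lt_irrefl y.2))
      (fun y => measure_mono_null
        (t := freeRegion (extendBy n γ y) (n + 1) ∩ closedUpperBall (γ n) ‖y - γ n‖)
        (fun z hz => ⟨hz.1.1, hz.2⟩) (volume_freeRegion_extendBy_inter n γ y))
    refine Eq.trans (lintegral_congr fun S => ?_) hmain
    · simp only [hF1]
      congr 1
      set y := ancestor (γ n) (S.carrier ∩ freeRegion γ n) with hy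
      have hy2 : (γ n).2 ≤ y.2 := le_ancestor_snd _ _
      -- Free regions decrease along the exploration, so restricting to the old one does not affect
      -- the void test in the new one.
      have hsub : freeRegion (extendBy n γ y) (n + 1) ⊆ freeRegion γ n := by
        intro z hz
        refine ⟨hy2.trans_lt ?_, fun hzH => hz.2 ⟨Or.inl ?_, hz.1⟩⟩
        · have := hz.1
          rwa [extendBy_succ] at this
        · rwa [history_congr fun k hk => extendBy_of_le γ y hk]
      have hiff : S.restrict (freeRegion γ n) ∈
          Config.void (freeRegion (extendBy n γ y) (n + 1) ∩ B) ↔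
          S ∈ Config.void (freeRegion (extendBy n γ y) (n + 1) ∩ B) := by
        rw [Config.restrict_mem_void, Set.inter_eq_right.2 (Set.inter_subset_left.trans hsub)]
      by_cases hS : S ∈ Config.void (freeRegion (extendBy n γ y) (n + 1) ∩ B)
      · exact (Set.indicator_of_mem (s := {q : (ℕ → ℝ × ℝ) × Config |
            q.2 ∈ Config.void (freeRegion q.1 (n + 1) ∩ B)})
            (a := (extendBy n γ y, S.restrict (freeRegion γ n))) (hiff.2 hS) _).trans
          (Set.indicator_of_mem hS (1 : Config → ℝ≥0∞)).symm
      · exact (Set.indicator_of_notMem (s := {q : (ℕ → ℝ × ℝ) × Config |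
            q.2 ∈ Config.void (freeRegion q.1 (n + 1) ∩ B)})
            (a := (extendBy n γ y, S.restrict (freeRegion γ n))) (fun h => hS (hiff.1 h)) _).trans
          (Set.indicator_of_notMem hS (1 : Config → ℝ≥0∞)).symm
  have hL : μ ((fun ω => (stopAt (n + 1) (g ω),
      (M ω).restrict (freeRegion (stopAt (n + 1) (g ω)) (n + 1)))) ⁻¹' (E ×ˢ Config.void B))
      = ∫⁻ ω, F1 (stopAt n (g ω), (M ω).restrict (freeRegion (stopAt n (g ω)) n)) ∂μ := by
    rw [← lintegral_indicator_one (hm1 hEB)]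
    refine lintegral_congr fun ω => ?_
    simp only [hF1, hfr]
    have hsub : freeRegion (stopAt (n + 1) (g ω)) (n + 1) ⊆ freeRegion (g ω) n := by
      rw [hfr1]; exact freeRegion_succ_subset (hmono ω) n
    have hiff : (M ω).restrict (freeRegion (g ω) n) ∈
        Config.void (freeRegion (stopAt (n + 1) (g ω)) (n + 1) ∩ B) ↔
        (M ω).restrict (freeRegion (stopAt (n + 1) (g ω)) (n + 1)) ∈ Config.void B := by
      rw [Config.restrict_mem_void, Config.restrict_mem_void,
        Set.inter_eq_right.2 (Set.inter_subset_left.trans hsub)]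
    classical
    simp only [Set.indicator_apply, Set.mem_preimage, Set.mem_prod, Set.mem_ofPred_eq,
      Pi.one_apply]
    split_ifs <;> simp_all
  have hR : (μ.prod P) ((fun p : Ω × Config => (stopAt (n + 1) (g p.1),
      p.2.restrict (freeRegion (stopAt (n + 1) (g p.1)) (n + 1)))) ⁻¹' (E ×ˢ Config.void B))
      = ∫⁻ ω, F2 (stopAt n (g ω), (M ω).restrict (freeRegion (stopAt n (g ω)) n)) ∂μ := by
    rw [Measure.prod_apply (hm2 hEB)]
    refine lintegral_congr fun ω => ?_
    simp only [hF2, hext]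
    by_cases hω : stopAt (n + 1) (g ω) ∈ E
    · rw [Set.indicator_of_mem hω, Pi.one_apply, one_mul]
      congr 1
      ext S
      simp only [Set.mem_preimage, Set.mem_prod, hω, true_and, Config.restrict_mem_void]
    · rw [Set.indicator_of_notMem hω, zero_mul]
      convert measure_empty (μ := P)
      ext S
      simp [hω]
  rw [hL, hR, h.lintegral_eq (hmst n) hM hF1m, h.lintegral_eq (hmst n) hM hF2m]
  exact lintegral_congr key

end Fresh

/-! ### Renewal steps, and the conditional tail bound. -/

theorem condExp_indicator_le_const {Ω : Type*} {m m0 : MeasurableSpace Ω} {μ : Measure Ω}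
    [IsProbabilityMeasure μ] (hm : m ≤ m0) {V : Set Ω} (hV : MeasurableSet V) {c : ℝ} (hc : 0 ≤ c)
    (h : ∀ A, MeasurableSet[m] A → μ (V ∩ A) ≤ ENNReal.ofReal c * μ A) :
    μ⟦V | m⟧ ≤ᵐ[μ] fun _ => c := by
  have hint : Integrable (V.indicator fun _ => (1 : ℝ)) μ := (integrable_const 1).indicator hV
  -- Passing to the trimmed measure reduces the comparison to integrals over sets of `m`, where the
  -- conditional expectation can be removed.
  refine ae_le_of_ae_le_trim (hm := hm) ?_
  have : IsProbabilityMeasure (μ.trim hm) := ⟨by rw [trim_measurableSet_eq hm .univ, measure_univ]⟩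
  refine ae_le_of_forall_setIntegral_le
    (integrable_condExp.trim hm stronglyMeasurable_condExp) (integrable_const c) fun A hA _ => ?_
  rw [← setIntegral_trim hm stronglyMeasurable_condExp hA, setIntegral_condExp hm hint hA,
    setIntegral_const, show (V.indicator fun _ => (1 : ℝ)) = V.indicator 1 from rfl,
    integral_indicator_one hV, smul_eq_mul, measureReal_def, measureReal_def,
    Measure.restrict_apply hV, trim_measurableSet_eq hm hA, mul_comm,
    ← ENNReal.toReal_ofReal hc, ← ENNReal.toReal_mul]
  refine ENNReal.toReal_mono (ENNReal.mul_ne_top ENNReal.ofReal_ne_top (measure_ne_top _ _)) ?_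
  exact h A hA

section Renewal
variable (g : ℕ → ℝ × ℝ)

theorem renewalStep_succ_le_iff (l i : ℕ) : renewalStep g (l + 1) ≤ i ↔
    ∃ k ≤ i, renewalStep g l < k ∧ history g k = ∅ := by
  rw [renewalStep]
  constructor
  · intro h
    have hne : {m : ℕ∞ | ∃ n : ℕ, m = n ∧ renewalStep g l < n ∧ history g n = ∅}.Nonempty := by
      by_contra hemp
      rw [Set.not_nonempty_iff_eq_empty.1 hemp, sInf_empty] at h
      exact absurd h (not_le.2 (ENat.natCast_lt_top i))
    obtain ⟨n, hn, h1, h2⟩ := csInf_mem hne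
    rw [hn] at h
    exact ⟨n, by exact_mod_cast h, h1, h2⟩
  · rintro ⟨k, hk, h1, h2⟩
    have hki : (k : ℕ∞) ≤ i := by exact_mod_cast hk
    exact sInf_le_of_le ⟨k, rfl, h1, h2⟩ hki

theorem history_eq_empty_of_renewalStep_eq {l m : ℕ} (h : renewalStep g l = m) :
    history g m = ∅ := by
  cases l with
  | zero =>
    have : (0 : ℕ∞) = m := h
    have hm : m = 0 := by exact_mod_cast this.symm
    rw [hm]; rfl
  | succ l =>
    obtain ⟨k, hk, h1, h2⟩ := (renewalStep_succ_le_iff g l m).1 h.le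
    have h3 := (renewalStep_succ_le_iff g l k).2 ⟨k, le_rfl, h1, h2⟩
    rw [h] at h3
    have : m ≤ k := by exact_mod_cast h3
    rwa [le_antisymm hk this] at h2

theorem history_ne_empty_of_lt_renewalStep_succ {l m j : ℕ} (h : renewalStep g l = m) (hj : m < j)
    (hlt : (j : ℕ∞) < renewalStep g (l + 1)) : history g j ≠ ∅ := by
  intro he
  refine absurd ((renewalStep_succ_le_iff g l j).2 ⟨j, le_rfl, ?_, he⟩) (not_le.2 hlt)
  rw [h]
  exact_mod_cast hj

/-- In `ℕ∞` subtracting `⊤` gives `0`, so the event forces `renewalStep g l` to be finite. -/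
theorem lt_renewalStep_sub_iff (l n : ℕ) : (n : ℕ∞) < renewalStep g (l + 1) - renewalStep g l ↔
    ∃ m : ℕ, renewalStep g l = m ∧ ¬ renewalStep g (l + 1) ≤ ((m + n : ℕ) : ℕ∞) := by
  constructor
  · intro h
    have hne : renewalStep g l ≠ ⊤ := by
      intro he
      rw [he, ENat.sub_top] at h
      exact not_lt_zero h
    obtain ⟨m, hm⟩ := ENat.ne_top_iff_exists.1 hne
    refine ⟨m, hm.symm, fun hle => absurd h (not_lt.2 ?_)⟩
    rw [← hm, tsub_le_iff_left]
    exact_mod_cast hle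
  · rintro ⟨m, hm, h⟩
    rw [not_le] at h
    rw [hm, lt_tsub_iff_left]
    exact_mod_cast h

end Renewal

section Exploration
variable {Ω : Type*} {mΩ : MeasurableSpace Ω} {μ : Measure Ω}
  {lam η ρ : ℝ} {g : ℕ → Ω → ℝ × ℝ} {M : ℕ → Ω → Config} {P : ℕ → Measure Config}

theorem measurable_stopAt_of_step {𝓖 : ℕ → MeasurableSpace Ω} (h𝓖 : Monotone 𝓖) {x : ℝ × ℝ}
    (h0 : ∀ ω, g 0 ω = x) (hM : ∀ n, Measurable[𝓖 (n + 1)] (M n))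
    (hstep : ∀ n ω, g (n + 1) ω =
      ancestor (g n ω) ((M n ω).carrier ∩ freeRegion (fun k => g k ω) n)) (n : ℕ) :
    Measurable[𝓖 n] fun ω => stopAt n fun k => g k ω := by
  induction n with
  | zero =>
    have : (fun ω => stopAt 0 fun k => g k ω) = fun _ _ => x := by
      funext ω k
      simp [stopAt, h0]
    rw [this]
    exact measurable_const
  | succ n ih =>
    have hG : Measurable fun p : (ℕ → ℝ × ℝ) × Config =>
        extendBy n p.1 (ancestor (p.1 n) (p.2.carrier ∩ freeRegion p.1 n)) :=
      (measurable_extendBy n).comp (measurable_fst.prodMk (measurable_ancestor_restrict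
        (x := fun g : ℕ → ℝ × ℝ => g n) (measurable_pi_apply n)
        (C := fun g => freeRegion g n) (measurableSet_mem_freeRegion n)))
    have ih' : Measurable[𝓖 (n + 1)] fun ω => stopAt n fun k => g k ω :=
      ih.mono (h𝓖 n.le_succ) le_rfl
    have : (fun ω => stopAt (n + 1) fun k => g k ω) =
        (fun p : (ℕ → ℝ × ℝ) × Config =>
          extendBy n p.1 (ancestor (p.1 n) (p.2.carrier ∩ freeRegion p.1 n))) ∘
        fun ω => (stopAt n fun k => g k ω, M n ω) := by
      funext ω
      simp only [Function.comp]
      rw [← extendBy_stopAt, stopAt_apply_of_le _ le_rfl,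
        freeRegion_congr fun k hk => stopAt_apply_of_le _ hk, hstep]
    rw [this]
    exact hG.comp (ih'.prodMk (hM n))

theorem measurable_stopAt_natural (hg : ∀ n, StronglyMeasurable (g n)) (n : ℕ) :
    Measurable[Filtration.natural g hg n] fun ω => stopAt n fun k => g k ω := by
  refine @measurable_pi_lambda _ _ _ (Filtration.natural g hg n) _ _ fun k => ?_
  have h1 : MeasurableSpace.comap (g (min k n)) inferInstance ≤ Filtration.natural g hg n :=
    le_iSup₂_of_le (f := fun j (_ : j ≤ n) => MeasurableSpace.comap (g j) inferInstance)
      (min k n) (min_le_right k n) le_rfl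
  exact measurable_iff_comap_le.2 h1

theorem natural_le_comap_stopAt (hg : ∀ n, StronglyMeasurable (g n)) (n : ℕ) :
    Filtration.natural g hg n ≤
      MeasurableSpace.comap (fun ω => stopAt n fun k => g k ω) inferInstance := by
  refine iSup₂_le fun j hj => ?_
  rintro _ ⟨A, hA, rfl⟩
  refine ⟨(fun γ : ℕ → ℝ × ℝ => γ j) ⁻¹' A, measurable_pi_apply j (by simpa using hA), ?_⟩
  ext ω
  simp [stopAt, hj]

theorem measurableSet_history_eq_empty (hg : ∀ n, StronglyMeasurable (g n))
    (hmono : ∀ ω n, (g n ω).2 ≤ (g (n + 1) ω).2) (n : ℕ) :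
    MeasurableSet[Filtration.natural g hg n] {ω | history (fun k => g k ω) n = ∅} := by
  have h1 := (measurable_historyHeight n).comp (measurable_stopAt_natural hg n)
  have h2 : {ω | history (fun k => g k ω) n = ∅} =
      ((fun γ : ℕ → ℝ × ℝ => historyHeight γ n) ∘ fun ω => stopAt n fun k => g k ω) ⁻¹' Set.Iic 0 := by
    ext ω
    rw [Set.mem_ofPred_eq, history_eq_empty_iff (hmono ω)]
    simp only [Set.mem_preimage, Function.comp, Set.mem_Iic]
    rw [historyHeight_congr fun k hk => stopAt_apply_of_le _ hk]
  rw [h2]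
  exact h1 measurableSet_Iic

theorem isStoppingTime_renewalStep (hg : ∀ n, StronglyMeasurable (g n))
    (hmono : ∀ ω n, (g n ω).2 ≤ (g (n + 1) ω).2) (l : ℕ) :
    IsStoppingTime (Filtration.natural g hg) (fun ω => renewalStep (fun k => g k ω) l) := by
  induction l with
  | zero => exact isStoppingTime_const _ 0
  | succ l ih =>
    intro i
    have : {ω | renewalStep (fun k => g k ω) (l + 1) ≤ (i : ℕ∞)} =
        ⋃ k ∈ Set.Iic i, {ω | renewalStep (fun k => g k ω) l < (k : ℕ∞)} ∩
          {ω | history (fun k => g k ω) k = ∅} := by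
      ext ω
      simp only [Set.mem_ofPred_eq, renewalStep_succ_le_iff, Set.mem_iUnion, Set.mem_Iic,
        Set.mem_inter_iff, exists_prop]
    refine (congrArg (MeasurableSet[Filtration.natural g hg i]) this).mpr ?_
    refine MeasurableSet.biUnion (Set.to_countable _) fun k hk => ?_
    exact (Filtration.natural g hg).mono hk _
      ((ih.measurableSet_lt k).inter (measurableSet_history_eq_empty hg hmono k))

/-- The Lyapunov function of the height of the history set decays geometrically. -/
theorem setLIntegral_lyapunov_succ_le [IsProbabilityMeasure μ]
    (hdrift : ∀ (P : Measure Config), IsPoissonLaw lam P → ∀ (x : ℝ × ℝ) (H : Set (ℝ × ℝ)) (l : ℝ),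
      IsObstacle x H l →
      ∫⁻ S, lyapunov η (nextHeight l x (ancestor x (S.carrier ∩ (upperHalfPlane x.2 \ H)))) ∂P
        ≤ ENNReal.ofReal (ρ * (1 + η * Real.exp l)))
    (hρ : 0 ≤ ρ) (hP : ∀ n, IsPoissonLaw lam (P n)) (hM : ∀ n, Measurable (M n))
    (hg : ∀ n, StronglyMeasurable (g n))
    (hmono : ∀ ω n, (g n ω).2 ≤ (g (n + 1) ω).2)
    (hstep : ∀ n ω, g (n + 1) ω =
      ancestor (g n ω) ((M n ω).carrier ∩ freeRegion (fun k => g k ω) n))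
    (hfresh : ∀ n, IsFresh μ (P n) (fun ω => stopAt n fun k => g k ω) (M n) n)
    (n : ℕ) {E : Set Ω} (hE : MeasurableSet[Filtration.natural g hg n] E) :
    ∫⁻ ω in E, lyapunov η (historyHeight (fun k => g k ω) (n + 1)) ∂μ
      ≤ ENNReal.ofReal ρ * ∫⁻ ω in E,
        ENNReal.ofReal (1 + η * Real.exp (historyHeight (fun k => g k ω) n)) ∂μ := by
  have := (hP n).isProbabilityMeasure
  obtain ⟨E', hE', rfl⟩ := natural_le_comap_stopAt hg n _ hE
  have hst : Measurable fun ω => stopAt n fun k => g k ω :=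
    (measurable_stopAt_natural hg n).mono ((Filtration.natural g hg).le n) le_rfl
  -- An event of the past is an event of the stopped path. Freshness then lets the drift bound be
  -- applied with the past fixed.
  set F : (ℕ → ℝ × ℝ) × Config → ℝ≥0∞ := fun p => E'.indicator 1 p.1 *
    lyapunov η (nextHeight (historyHeight p.1 n) (p.1 n) (ancestor (p.1 n) p.2.carrier)) with hF
  have hFm : Measurable F := by
    refine ((measurable_one.indicator hE').comp measurable_fst).mul
      ((measurable_lyapunov η).comp ?_)
    have h1 : Measurable fun p : (ℕ → ℝ × ℝ) × Config => ancestor (p.1 n) p.2.carrier :=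
      measurable_ancestor (x := fun g : ℕ → ℝ × ℝ => g n) (measurable_pi_apply n)
    have h2 : Measurable fun p : (ℕ → ℝ × ℝ) × Config => historyHeight p.1 n :=
      (measurable_historyHeight n).comp measurable_fst
    unfold nextHeight
    fun_prop
  have hEm : MeasurableSet ((fun ω => stopAt n fun k => g k ω) ⁻¹' E') := hst hE'
  have hsa : ∀ ω, ∀ k ≤ n, (stopAt n fun k => g k ω) k = g k ω := fun ω k hk =>
    stopAt_apply_of_le (fun k => g k ω) hk
  have hl : ∫⁻ ω in (fun ω => stopAt n fun k => g k ω) ⁻¹' E',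
      lyapunov η (historyHeight (fun k => g k ω) (n + 1)) ∂μ =
      ∫⁻ ω, F (stopAt n fun k => g k ω,
        (M n ω).restrict (freeRegion (stopAt n fun k => g k ω) n)) ∂μ := by
    rw [← lintegral_indicator hEm]
    refine lintegral_congr fun ω => ?_
    simp only [hF, Config.restrict, freeRegion_congr (hsa ω), hsa ω n le_rfl, ← hstep n ω,
      historyHeight_congr (hsa ω)]
    by_cases hω : (stopAt n fun k => g k ω) ∈ E'
    · rw [Set.indicator_of_mem hω, Set.indicator_of_mem (by exact hω), Pi.one_apply, one_mul]
      rfl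
    · rw [Set.indicator_of_notMem hω, Set.indicator_of_notMem (by exact hω), zero_mul]
  rw [hl, (hfresh n).lintegral_eq hst (hM n) hFm, ← lintegral_const_mul' _ _ ENNReal.ofReal_ne_top,
    ← lintegral_indicator hEm]
  refine lintegral_mono fun ω => ?_
  have hobs := isObstacle_history (hmono ω) n
  have hd := hdrift (P n) (hP n) _ _ _ hobs
  by_cases hω : (stopAt n fun k => g k ω) ∈ E'
  · rw [Set.indicator_of_mem (by exact hω), ← ENNReal.ofReal_mul hρ]
    refine le_trans (le_of_eq (lintegral_congr fun S => ?_)) hd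
    simp only [hF]
    rw [Set.indicator_of_mem hω, Pi.one_apply, one_mul, hsa ω n le_rfl,
      historyHeight_congr (hsa ω), freeRegion_congr (hsa ω)]
    rfl
  · simp only [hF]
    simp [Set.indicator_of_notMem hω]

/-- The history set stays nonempty for `k` further steps with exponentially small probability. -/
theorem measure_history_ne_empty_le [IsProbabilityMeasure μ] (hρ : 0 ≤ ρ) (hη : 0 ≤ η)
    (hg : ∀ n, StronglyMeasurable (g n))
    (hmono : ∀ ω n, (g n ω).2 ≤ (g (n + 1) ω).2)
    (hdecay : ∀ (n : ℕ) (E : Set Ω), MeasurableSet[Filtration.natural g hg n] E →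
      ∫⁻ ω in E, lyapunov η (historyHeight (fun k => g k ω) (n + 1)) ∂μ
      ≤ ENNReal.ofReal ρ * ∫⁻ ω in E,
        ENNReal.ofReal (1 + η * Real.exp (historyHeight (fun k => g k ω) n)) ∂μ)
    {m : ℕ} {E : Set Ω} (hE : MeasurableSet[Filtration.natural g hg m] E)
    (hEm : ∀ ω ∈ E, history (fun k => g k ω) m = ∅) (k : ℕ) :
    μ (E ∩ {ω | ∀ j, 1 ≤ j → j ≤ k → history (fun k => g k ω) (m + j) ≠ ∅})
      ≤ ENNReal.ofReal ((1 + η) * ρ ^ k) * μ E := by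
  set V : ℕ → Set Ω := fun k =>
    E ∩ {ω | ∀ j, 1 ≤ j → j ≤ k → history (fun k => g k ω) (m + j) ≠ ∅} with hV
  have hVsucc : ∀ k, V (k + 1) = V k ∩ {ω | history (fun k => g k ω) (m + k + 1) = ∅}ᶜ := by
    intro k
    ext ω
    simp only [hV, Set.mem_inter_iff, Set.mem_ofPred_eq, Set.mem_compl_iff]
    constructor
    · rintro ⟨h1, h2⟩
      exact ⟨⟨h1, fun j h3 h4 => h2 j h3 (by omega)⟩, h2 (k + 1) (by omega) le_rfl⟩
    · rintro ⟨⟨h1, h2⟩, h3⟩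
      refine ⟨h1, fun j h4 h5 => ?_⟩
      rcases Nat.lt_or_ge k j with h6 | h6
      · obtain rfl : j = k + 1 := by omega
        exact h3
      · exact h2 j h4 h6
  have hVm : ∀ k, MeasurableSet[Filtration.natural g hg (m + k)] (V k) := by
    intro k
    induction k with
    | zero =>
      have : V 0 = E := by
        ext ω; simp only [hV, Set.mem_inter_iff, Set.mem_ofPred_eq, and_iff_left_iff_imp]
        intro _ j h1 h2; omega
      rw [this]; exact hE
    | succ k ih =>
      rw [hVsucc]
      exact MeasurableSet.inter ((Filtration.natural g hg).mono (by omega) _ ih)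
        (measurableSet_history_eq_empty hg hmono (m + k + 1)).compl
  -- The induction carries the weighted integral rather than the probability. On `V (k + 1)` the
  -- history set is nonempty, so the Lyapunov function is not killed there and each step costs a
  -- factor `ρ`.
  have hbound : ∀ k, ∫⁻ ω in V k,
      ENNReal.ofReal (1 + η * Real.exp (historyHeight (fun k => g k ω) (m + k))) ∂μ
      ≤ ENNReal.ofReal ((1 + η) * ρ ^ k) * μ E := by
    intro k
    induction k with
    | zero =>
      have hEm' : MeasurableSet E := (Filtration.natural g hg).le m _ hE
      calc ∫⁻ ω in V 0, ENNReal.ofReal (1 + η * Real.exp (historyHeight (fun k => g k ω) m)) ∂μ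
          ≤ ∫⁻ ω in E, ENNReal.ofReal (1 + η * Real.exp (historyHeight (fun k => g k ω) m)) ∂μ :=
            lintegral_mono_set Set.inter_subset_left
        _ = ∫⁻ ω in E, ENNReal.ofReal (1 + η) ∂μ := by
            refine setLIntegral_congr_fun hEm' fun ω hω => ?_
            have h1 := (history_eq_empty_iff (hmono ω) m).1 (hEm ω hω)
            have h2 := le_antisymm h1 (historyHeight_nonneg _ _)
            simp only [h2, Real.exp_zero, mul_one]
        _ = _ := by rw [setLIntegral_const, pow_zero, mul_one]
    | succ k ih =>
      have hS : MeasurableSet {ω | history (fun k => g k ω) (m + k + 1) = ∅}ᶜ :=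
        ((Filtration.natural g hg).le _ _
          (measurableSet_history_eq_empty hg hmono (m + k + 1))).compl
      calc ∫⁻ ω in V (k + 1),
            ENNReal.ofReal (1 + η * Real.exp (historyHeight (fun k => g k ω) (m + k + 1))) ∂μ
          ≤ ∫⁻ ω in V k, lyapunov η (historyHeight (fun k => g k ω) (m + k + 1)) ∂μ := by
            have hVk : MeasurableSet (V (k + 1)) := (Filtration.natural g hg).le _ _ (hVm (k + 1))
            refine le_trans (setLIntegral_mono' hVk fun ω hω => ?_)
              (lintegral_mono_set (t := V k) (by rw [hVsucc]; exact Set.inter_subset_left))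
            rw [hVsucc] at hω
            have : ¬ historyHeight (fun k => g k ω) (m + k + 1) ≤ 0 := fun h =>
              hω.2 ((history_eq_empty_iff (hmono ω) _).2 h)
            rw [lyapunov, if_neg this]
        _ ≤ ENNReal.ofReal ρ * (ENNReal.ofReal ((1 + η) * ρ ^ k) * μ E) :=
            (hdecay (m + k) _ (hVm k)).trans (by gcongr)
        _ = _ := by
            rw [← mul_assoc, ← ENNReal.ofReal_mul hρ]
            congr 2; ring
  refine le_trans ?_ (hbound k)
  rw [← setLIntegral_one]
  refine lintegral_mono fun ω => ?_
  rw [← ENNReal.ofReal_one]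
  exact ENNReal.ofReal_le_ofReal (by
    have := mul_nonneg hη (Real.exp_pos (historyHeight (fun k => g k ω) (m + k))).le
    linarith)

end Exploration

section Exploration
variable {Ω : Type*} {mΩ : MeasurableSpace Ω} {μ : Measure Ω} [IsProbabilityMeasure μ]
  {c ρ : ℝ} {g : ℕ → Ω → ℝ × ℝ}

theorem ae_renewalStep_lt_top (hρ0 : 0 ≤ ρ) (hρ1 : ρ < 1)
    (hg : ∀ n, StronglyMeasurable (g n)) (hmono : ∀ ω n, (g n ω).2 ≤ (g (n + 1) ω).2)
    (htail : ∀ (m : ℕ) (E : Set Ω), MeasurableSet[Filtration.natural g hg m] E →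
      (∀ ω ∈ E, history (fun k => g k ω) m = ∅) → ∀ k : ℕ,
      μ (E ∩ {ω | ∀ j, 1 ≤ j → j ≤ k → history (fun k => g k ω) (m + j) ≠ ∅})
        ≤ ENNReal.ofReal (c * ρ ^ k) * μ E) (l : ℕ) :
    ∀ᵐ ω ∂μ, renewalStep (fun k => g k ω) l < ⊤ := by
  induction l with
  | zero => exact Filter.Eventually.of_forall fun ω => ENat.natCast_lt_top 0
  | succ l ih =>
    have hnull : ∀ m : ℕ, μ {ω | renewalStep (fun k => g k ω) l = m ∧
        renewalStep (fun k => g k ω) (l + 1) = ⊤} = 0 := by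
      intro m
      have hlim : Filter.Tendsto (fun k : ℕ => ENNReal.ofReal (c * ρ ^ k)) Filter.atTop
          (nhds 0) := by
        rw [← ENNReal.ofReal_zero, ← mul_zero c]
        exact ENNReal.tendsto_ofReal ((tendsto_pow_atTop_nhds_zero_of_lt_one hρ0 hρ1).const_mul c)
      refine le_antisymm (ge_of_tendsto' hlim fun k => ?_) zero_le
      have hE := (isStoppingTime_renewalStep hg hmono l).measurableSet_eq m
      calc μ {ω | renewalStep (fun k => g k ω) l = m ∧
              renewalStep (fun k => g k ω) (l + 1) = ⊤}
          ≤ μ ({ω | renewalStep (fun k => g k ω) l = m} ∩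
              {ω | ∀ j, 1 ≤ j → j ≤ k → history (fun k => g k ω) (m + j) ≠ ∅}) := by
            refine measure_mono fun ω hω => ⟨hω.1, fun j hj _ => ?_⟩
            refine history_ne_empty_of_lt_renewalStep_succ _ hω.1 (by omega) ?_
            rw [hω.2]
            exact ENat.natCast_lt_top _
        _ ≤ ENNReal.ofReal (c * ρ ^ k) * μ {ω | renewalStep (fun k => g k ω) l = m} :=
            htail m _ hE (fun ω hω => history_eq_empty_of_renewalStep_eq _ hω) k
        _ ≤ ENNReal.ofReal (c * ρ ^ k) := mul_le_of_le_one_right' prob_le_one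
    have hall : ∀ᵐ ω ∂μ, ∀ m : ℕ, ¬ (renewalStep (fun k => g k ω) l = m ∧
        renewalStep (fun k => g k ω) (l + 1) = ⊤) :=
      ae_all_iff.2 fun m => measure_eq_zero_iff_ae_notMem.1 (hnull m)
    filter_upwards [ih, hall] with ω h1 h2
    obtain ⟨m, hm⟩ := ENat.ne_top_iff_exists.1 h1.ne
    exact lt_top_iff_ne_top.2 fun h3 => h2 m ⟨hm.symm, h3⟩

theorem condExp_renewalStep_le (hρ0 : 0 ≤ ρ) (hc : 0 ≤ c)
    (hg : ∀ n, StronglyMeasurable (g n)) (hmono : ∀ ω n, (g n ω).2 ≤ (g (n + 1) ω).2)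
    (htail : ∀ (m : ℕ) (E : Set Ω), MeasurableSet[Filtration.natural g hg m] E →
      (∀ ω ∈ E, history (fun k => g k ω) m = ∅) → ∀ k : ℕ,
      μ (E ∩ {ω | ∀ j, 1 ≤ j → j ≤ k → history (fun k => g k ω) (m + j) ≠ ∅})
        ≤ ENNReal.ofReal (c * ρ ^ k) * μ E) (l n : ℕ)
    (hβ : IsStoppingTime (Filtration.natural g hg) (fun ω => renewalStep (fun k => g k ω) l)) :
    μ⟦{ω | (n : ℕ∞) < renewalStep (fun k => g k ω) (l + 1) - renewalStep (fun k => g k ω) l} |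
      hβ.measurableSpace⟧ ≤ᵐ[μ] fun _ => c * ρ ^ n := by
  have hβ' := isStoppingTime_renewalStep hg hmono (l + 1)
  have hle := (Filtration.natural g hg).le
  have heq : ∀ m : ℕ, MeasurableSet[Filtration.natural g hg m]
      {ω | renewalStep (fun k => g k ω) l = m} := fun m => hβ.measurableSet_eq m
  -- Splitting by the value `m` of `β_ℓ` replaces the random time by fixed times, at which the
  -- history set is empty and the tail bound applies.
  have hV : {ω | (n : ℕ∞) < renewalStep (fun k => g k ω) (l + 1) - renewalStep (fun k => g k ω) l}
      = ⋃ m : ℕ, {ω | renewalStep (fun k => g k ω) l = m} ∩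
        {ω | renewalStep (fun k => g k ω) (l + 1) ≤ ((m + n : ℕ) : ℕ∞)}ᶜ := by
    ext ω
    simp only [Set.mem_ofPred_eq, lt_renewalStep_sub_iff, Set.mem_iUnion, Set.mem_inter_iff,
      Set.mem_compl_iff]
  have hVm : MeasurableSet {ω | (n : ℕ∞) < renewalStep (fun k => g k ω) (l + 1) -
      renewalStep (fun k => g k ω) l} := by
    rw [hV]
    exact MeasurableSet.iUnion fun m => (hle m _ (heq m)).inter (hle _ _ (hβ' (m + n))).compl
  refine condExp_indicator_le_const hβ.measurableSpace_le hVm (by positivity) fun A hA => ?_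
  have hAm : ∀ m : ℕ, MeasurableSet[Filtration.natural g hg m]
      (A ∩ {ω | renewalStep (fun k => g k ω) l = m}) := by
    intro m
    have : A ∩ {ω | renewalStep (fun k => g k ω) l = m} =
        (A ∩ {ω | renewalStep (fun k => g k ω) l ≤ m}) ∩
          {ω | renewalStep (fun k => g k ω) l = m} := by
      ext ω
      simp only [Set.mem_inter_iff, Set.mem_ofPred_eq]
      constructor
      · rintro ⟨h1, h2⟩; exact ⟨⟨h1, h2.le⟩, h2⟩
      · rintro ⟨⟨h1, -⟩, h2⟩; exact ⟨h1, h2⟩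
    rw [this]
    exact MeasurableSet.inter (hA.2 m) (heq m)
  rw [hV, Set.iUnion_inter]
  calc μ (⋃ m : ℕ, {ω | renewalStep (fun k => g k ω) l = m} ∩
        {ω | renewalStep (fun k => g k ω) (l + 1) ≤ ((m + n : ℕ) : ℕ∞)}ᶜ ∩ A)
      ≤ ∑' m : ℕ, μ ({ω | renewalStep (fun k => g k ω) l = m} ∩
        {ω | renewalStep (fun k => g k ω) (l + 1) ≤ ((m + n : ℕ) : ℕ∞)}ᶜ ∩ A) :=
        measure_iUnion_le _
    _ ≤ ∑' m : ℕ, ENNReal.ofReal (c * ρ ^ n) *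
        μ (A ∩ {ω | renewalStep (fun k => g k ω) l = m}) := by
        refine ENNReal.tsum_le_tsum fun m => ?_
        refine le_trans (measure_mono ?_) (htail m _ (hAm m)
          (fun ω hω => history_eq_empty_of_renewalStep_eq _ hω.2) n)
        rintro ω ⟨⟨h1, h2⟩, h3⟩
        refine ⟨⟨h3, h1⟩, fun j hj hjn => ?_⟩
        refine history_ne_empty_of_lt_renewalStep_succ _ h1 (by omega) ?_
        refine lt_of_le_of_lt ?_ (not_le.1 h2)
        exact_mod_cast Nat.add_le_add_left hjn m
    _ = ENNReal.ofReal (c * ρ ^ n) *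
        μ (⋃ m : ℕ, A ∩ {ω | renewalStep (fun k => g k ω) l = m}) := by
        rw [ENNReal.tsum_mul_left, measure_iUnion]
        · intro i j hij
          refine Set.disjoint_left.2 fun ω h1 h2 => hij ?_
          have h3 : ((i : ℕ) : ℕ∞) = j := h1.2.symm.trans h2.2
          exact_mod_cast h3
        · exact fun m => hle m _ (hAm m)
    _ ≤ ENNReal.ofReal (c * ρ ^ n) * μ A := by
        gcongr
        exact Set.iUnion_subset fun m => Set.inter_subset_left

end Exploration

/-! ### Both explorations have fresh points at every step. -/

section Cases
variable {Ω : Type*} [mΩ : MeasurableSpace Ω] {μ : Measure Ω} [IsProbabilityMeasure μ] {lam : ℝ}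

/-- The points used for the steps of an exploration, given by the laws `P n` and the random
configurations `M n`, are fresh at each step. -/
structure IsExploration (μ : Measure Ω) (lam : ℝ) (g : ℕ → Ω → ℝ × ℝ) (M : ℕ → Ω → Config)
    (P : ℕ → Measure Config) : Prop where
  isPoissonLaw : ∀ n, IsPoissonLaw lam (P n)
  measurable_config : ∀ n, Measurable (M n)
  measurable_stopAt : ∀ n, Measurable fun ω => stopAt n fun k => g k ω
  step : ∀ n ω, g (n + 1) ω =
      ancestor (g n ω) ((M n ω).carrier ∩ freeRegion (fun k => g k ω) n)
  isFresh : ∀ n, IsFresh μ (P n) (fun ω => stopAt n fun k => g k ω) (M n) n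

omit [IsProbabilityMeasure μ] in
theorem IsExploration.stronglyMeasurable {g : ℕ → Ω → ℝ × ℝ} {M : ℕ → Ω → Config}
    {P : ℕ → Measure Config} (h : IsExploration μ lam g M P) (n : ℕ) :
    StronglyMeasurable (g n) := by
  have := (measurable_pi_apply n).comp (h.measurable_stopAt n)
  have h2 : (fun γ : ℕ → ℝ × ℝ => γ n) ∘ (fun ω => stopAt n fun k => g k ω) = g n := by
    funext ω
    exact stopAt_apply_of_le (fun k => g k ω) le_rfl
  rw [h2] at this
  exact this.stronglyMeasurable

theorem isExploration_path (hlam : 0 < lam) {N : Ω → Set (ℝ × ℝ)} (h : IsPoissonProcess μ lam N)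
    (x : ℝ × ℝ) : IsExploration μ lam (fun n ω => path (N ω) x n) (fun _ => h.config)
      (fun _ => μ.map h.config) := by
  have hst : ∀ n, Measurable fun ω => stopAt n fun k => path (N ω) x k := fun n =>
    measurable_stopAt_of_step (𝓖 := fun _ => mΩ) (fun _ _ _ => le_rfl) (x := x)
      (g := fun n ω => path (N ω) x n) (fun _ => rfl) (M := fun _ => h.config)
      (fun _ => h.measurable_config) (fun n ω => path_succ (N ω) x n) n
  have hpath : Measurable fun ω => path (N ω) x := by
    refine measurable_pi_lambda _ fun n => ?_
    have h1 := (measurable_pi_apply n).comp (hst n)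
    have h2 : (fun γ : ℕ → ℝ × ℝ => γ n) ∘ (fun ω => stopAt n (path (N ω) x)) =
        fun ω => path (N ω) x n := by
      funext ω
      exact stopAt_apply_of_le (path (N ω) x) le_rfl
    rwa [← h2]
  refine ⟨fun _ => h.isPoissonLaw hlam.le, fun _ => h.measurable_config, hst,
    fun n ω => path_succ (N ω) x n, fun n => ?_⟩
  induction n with
  | zero =>
    refine IsFresh.of_indepFun (hst 0) h.measurable_config ?_ 0
    have : (fun ω => stopAt 0 fun k => path (N ω) x k) = fun _ _ => x := by
      funext ω k
      simp [stopAt, path]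
    rw [this]
    exact indepFun_const_left _ _
  | succ n ih =>
    exact IsFresh.succ (h.isPoissonLaw hlam.le) hlam hpath h.measurable_config
      (fun ω => path_snd_mono (N ω) x) (fun ω => path_succ (N ω) x n) ih

theorem isExploration_resampledPath (hlam : 0 < lam) {N : ℕ → Ω → Set (ℝ × ℝ)}
    (h : ∀ i, IsPoissonProcess μ lam (N i)) (hind : iIndep (fun i => pointSigma (N i)) μ)
    (x : ℝ × ℝ) : IsExploration μ lam (fun n ω => resampledPath (fun i => N i ω) x n)
      (fun n => (h (n + 1)).config) (fun n => μ.map (h (n + 1)).config) := by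
  -- Step `n + 1` uses the process with index `n + 1`, so the path up to `n` is measurable for `𝓖 n`
  -- and independent of the points used next.
  set 𝓖 : ℕ → MeasurableSpace Ω := fun n => ⨆ i ∈ Set.Iic n, pointSigma (N i) with h𝓖
  have hmono : Monotone 𝓖 := fun a b hab => biSup_mono fun i hi => le_trans hi hab
  have h𝓖le : ∀ n, 𝓖 n ≤ mΩ := fun n => iSup₂_le fun i _ => (h i).pointSigma_le
  have hst : ∀ n, Measurable[𝓖 n] fun ω => stopAt n fun k => resampledPath (fun i => N i ω) x k :=
    measurable_stopAt_of_step hmono (x := x)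
      (g := fun n ω => resampledPath (fun i => N i ω) x n) (fun _ => rfl)
      (M := fun n => (h (n + 1)).config)
      (fun n => measurable_iff_comap_le.2 ((h (n + 1)).comap_config_le.trans
        (le_iSup₂_of_le (f := fun i (_ : i ∈ Set.Iic (n + 1)) => pointSigma (N i))
          (n + 1) Set.self_mem_Iic le_rfl)))
      (fun n ω => resampledPath_succ (fun i => N i ω) x n)
  refine ⟨fun n => (h (n + 1)).isPoissonLaw hlam.le, fun n => (h (n + 1)).measurable_config,
    fun n => (hst n).mono (h𝓖le n) le_rfl, fun n ω => resampledPath_succ (fun i => N i ω) x n,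
    fun n => ?_⟩
  refine IsFresh.of_indepFun ((hst n).mono (h𝓖le n) le_rfl) (h (n + 1)).measurable_config ?_ n
  have h1 := indep_iSup_of_disjoint (fun i => (h i).pointSigma_le) hind
    (S := Set.Iic n) (T := {n + 1}) (by simp)
  rw [iSup_singleton] at h1
  exact indep_of_indep_of_le_left (indep_of_indep_of_le_right h1 (h (n + 1)).comap_config_le)
    (measurable_iff_comap_le.1 (hst n))

end Cases
end DSF

end

theorem proposition3p1 (lam : ℝ) (hlam : 0 < lam) :
    ∃ c₀ c₁ : ℝ, 0 < c₀ ∧ 0 < c₁ ∧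
      ∀ (Ω : Type*) [MeasurableSpace Ω] (μ : Measure Ω) [IsProbabilityMeasure μ] (x : ℝ × ℝ)
        (g : ℕ → Ω → ℝ × ℝ),
        -- `g` is a path of the forest of one Poisson process, or its resampled exploration
        ((∃ N : Ω → Set (ℝ × ℝ), DSF.IsPoissonProcess μ lam N ∧
            ∀ n ω, g n ω = DSF.path (N ω) x n) ∨
          (∃ N : ℕ → Ω → Set (ℝ × ℝ), (∀ i, DSF.IsPoissonProcess μ lam (N i)) ∧
            iIndep (fun i => DSF.pointSigma (N i)) μ ∧
            ∀ n ω, g n ω = DSF.resampledPath (fun i => N i ω) x n)) →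
        ∃ (hg : ∀ n, StronglyMeasurable (g n))
          (hβ : ∀ l, IsStoppingTime (Filtration.natural g hg)
            (fun ω => DSF.renewalStep (fun k => g k ω) l)),
          (∀ l, ∀ᵐ ω ∂μ, DSF.renewalStep (fun k => g k ω) l < ⊤) ∧
          ∀ l n : ℕ,
            μ⟦{ω | (n : ℕ∞) < DSF.renewalStep (fun k => g k ω) (l + 1)
                - DSF.renewalStep (fun k => g k ω) l} | (hβ l).measurableSpace⟧
              ≤ᵐ[μ] fun _ => c₀ * Real.exp (-(c₁ * n)) := by
  obtain ⟨η, ρ, hη, hρ0, hρ1, hdrift⟩ := DSF.exists_lyapunov_drift hlam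
  -- The prefactor is the value of `1 + η * exp l` at a renewal, and `exp (-c₁) = ρ`.
  refine ⟨1 + η, -Real.log ρ, by linarith, neg_pos.2 (Real.log_neg hρ0 hρ1), ?_⟩
  intro Ω _ μ _ x g hgN
  have hexpl : ∃ M P, DSF.IsExploration μ lam g M P := by
    rcases hgN with ⟨N, hN, hg⟩ | ⟨N, hN, hind, hg⟩
    · obtain rfl : g = fun n ω => DSF.path (N ω) x n := funext fun n => funext fun ω => hg n ω
      exact ⟨_, _, DSF.isExploration_path hlam hN x⟩
    · obtain rfl : g = fun n ω => DSF.resampledPath (fun i => N i ω) x n :=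
        funext fun n => funext fun ω => hg n ω
      exact ⟨_, _, DSF.isExploration_resampledPath hlam hN hind x⟩
  obtain ⟨M, P, he⟩ := hexpl
  have hmono : ∀ ω n, (g n ω).2 ≤ (g (n + 1) ω).2 := fun ω n => by
    rw [he.step n ω]
    exact DSF.le_ancestor_snd _ _
  have hg := he.stronglyMeasurable
  have htail := fun (m : ℕ) (E : Set Ω) (hE : MeasurableSet[Filtration.natural g hg m] E) hEm k =>
    DSF.measure_history_ne_empty_le hρ0.le hη.le hg hmono (fun n E hE =>
      DSF.setLIntegral_lyapunov_succ_le hdrift hρ0.le he.isPoissonLaw he.measurable_config hg hmono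
        he.step he.isFresh n hE) hE hEm k
  refine ⟨hg, DSF.isStoppingTime_renewalStep hg hmono,
    DSF.ae_renewalStep_lt_top hρ0.le hρ1 hg hmono htail, fun l n => ?_⟩
  have hexp : Real.exp (-(-Real.log ρ * n)) = ρ ^ n := by
    rw [neg_mul, neg_neg, mul_comm, Real.exp_nat_mul, Real.exp_log hρ0]
  rw [hexp]
  exact DSF.condExp_renewalStep_le hρ0.le (by linarith) hg hmono htail l n _
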